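/- Let $K$ be a field and let $$A=K\langle x_1,\dots,x_n\mid x_jx_i=c_{ij}\,x_ix_j+d_{ij},\ 1\le i<j\le n\rangle$$ be a $G$-algebra. That is, the $c_{ij}\in K$ are nonzero, the $d_{ij}=\sum_\alpha c^{(ij)}_\alpha x^\alpha$ are standard polynomials (finite linear combinations of standard monomials $x^\alpha=x_1^{\alpha_1}\cdots x_n^{\alpha_n}$, $\alpha\in\mathbb N^n$), and (1) there is a monomial ordering $>$ on $\mathbb N^n$ (a total well-ordering compatible with addition) with $d_{ij}=0$ or $\epsilon_i+\epsilon_j>\exp_>(d_{ij})$ for all $i<j$, where $\exp_>$ is the leading exponent and $\epsilon_i$ is the $i$-th unit vector (every such ordering is called admissible); (2) for all $i<j<k$ the element $$c_{ik}c_{jk}\,d_{ij}x_k-x_kd_{ij}+c_{jk}\,x_jd_{ik}-c_{ij}\,d_{ik}x_j+d_{jk}x_i-c_{ij}c_{ik}\,x_id_{jk}$$ of the free algebra reduces to zero by means of the rewriting rules $x_jx_i\to c_{ij}x_ix_j+d_{ij}$ ($i<j$). The standard monomials then form a $K$-basis of $A$. A $G$-algebra is called graded with respect to a nonzero weight vector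 $\omega$ if all $c_{ij}x_ix_j+d_{ij}$ are homogeneous for the $\omega$-weighted degree $|\alpha|_\omega=\sum_i\omega_i\alpha_i$; a linear combination $f$ of standard monomials has $\deg_\omega f=\max|\alpha|_\omega$ over the $\alpha$ occurring in $f$. Let $\omega\in\mathbb N_{\ge1}^n$ satisfy $\omega_i+\omega_j>|\alpha|_\omega$ for all $i<j$ and all $\alpha$ with $c^{(ij)}_\alpha\ne0$. Put $F_d^\omega A=\{f\in A\mid\deg_\omega f\le d\}$ for $d\in\mathbb N$, and let $\widetilde\omega=(\omega,1)\in\mathbb N^{n+1}$. In $A[t]$, with $t$ central, let $R^\omega A$ be the Rees algebra of this filtration, that is, the subalgebra generated by the subspaces $(F^\omega_dA)t^d$, $d\geq 0$, and put $\tilde x_i=x_it^{\omega_i}$ and $$\tilde d_{ij}=d_{ij}t^{\omega_i+\omega_j}=\sum_\alpha c^{(ij)}_\alpha\,\tilde x^\alpha t^{\omega_i+\omega_j-|\alpha|_\omega}.$$ Given any monomial ordering $>$ on $\mathbb N^n$, let $\alpha>_\omega\beta$ if $|\alpha|_\omega>|\beta|_\omega$, or $|\alpha|_\omega=|\beta|_\omega$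 and $\alpha>\beta$; and for $(\alpha,d),(\beta,e)\in\mathbb N^n\times\mathbb N$ let $(\alpha,d)>^h_\omega(\beta,e)$ if $|\alpha|_\omega+d>|\beta|_\omega+e$, or $|\alpha|_\omega+d=|\beta|_\omega+e$ and $\alpha>_\omega\beta$. Then $R^\omega A=\bigoplus_{d\ge0}(F^\omega_dA)t^d$ is a graded algebra, and it is a $G$-algebra, graded with respect to $\widetilde\omega$, with the presentation $$R^\omega A=K\langle\tilde x_1,\dots,\tilde x_n,t\mid \tilde x_j\tilde x_i=c_{ij}\,\tilde x_i\tilde x_j+\tilde d_{ij}\ (1\le i<j\le n),\ \ t\tilde x_i=\tilde x_it\ (1\le i\le n)\rangle,$$ for which the ordering $>^h_\omega$ is admissible. The elements of $R^\omega A$ that are $\widetilde\omega$-homogeneous of degree $d$ are exactly those of $(F^\omega_dA)t^d$. -/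

import Mathlib

noncomputable section

namespace GAlg

/-! ### Standard monomials, standard polynomials, monomial orderings -/

/-- The free associative algebra `K⟨x₁, …, xₙ⟩`: the monoid algebra of the free monoid. -/
abbrev FreeAlg (K : Type*) [Field K] (n : ℕ) : Type _ := MonoidAlgebra K (FreeMonoid (Fin n))

/-- Coefficient families of standard polynomials `∑ c_α x^α`; the Newton diagram of `p` is
`p.support`. -/
abbrev StdPoly (K : Type*) [Field K] (n : ℕ) : Type _ := (Fin n → ℕ) →₀ K

/-- The standard monomial `x₁^α₁ ⋯ xₙ^αₙ`, as a word. -/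
def stdWord {n : ℕ} (α : Fin n → ℕ) : FreeMonoid (Fin n) :=
  (List.ofFn fun i => FreeMonoid.of i ^ α i).prod

/-- The indeterminate `x_i` in the free algebra. -/
def fvar (K : Type*) [Field K] {n : ℕ} (i : Fin n) : FreeAlg K n :=
  MonoidAlgebra.of K (FreeMonoid (Fin n)) (FreeMonoid.of i)

/-- The element `∑ c_α x^α` of the free algebra given by a coefficient family. -/
def stdToFree {K : Type*} [Field K] {n : ℕ} : StdPoly K n →ₗ[K] FreeAlg K n :=
  Finsupp.linearCombination K fun α => MonoidAlgebra.of K (FreeMonoid (Fin n)) (stdWord α)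

/-- The exponent vector `ε_i` of `x_i`. -/
def eps {n : ℕ} (i : Fin n) : Fin n → ℕ := Pi.single i 1

/-- The weighted degree `|α|_ω = ∑ ω_i α_i`. -/
def wdeg {n : ℕ} (ω α : Fin n → ℕ) : ℕ := ∑ i, ω i * α i

/-- `gt α β`, read `α > β`, is a monomial ordering: a (strict) total ordering on `ℕⁿ`, compatible
with addition, and a well-ordering. -/
structure IsMonomialOrdering {n : ℕ} (gt : (Fin n → ℕ) → (Fin n → ℕ) → Prop) : Prop where
  irrefl : ∀ α, ¬ gt α α
  trans : ∀ α β γ, gt α β → gt β γ → gt α γ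
  total : ∀ α β, α ≠ β → gt α β ∨ gt β α
  add_right : ∀ α β γ, gt α β → gt (α + γ) (β + γ)
  wf : WellFounded fun α β => gt β α

/-- `α = exp_>(p)` is the leading exponent of `p` (so `p ≠ 0`). -/
def IsLeadingExponent {K : Type*} [Field K] {n : ℕ} (gt : (Fin n → ℕ) → (Fin n → ℕ) → Prop)
    (p : StdPoly K n) (α : Fin n → ℕ) : Prop :=
  α ∈ p.support ∧ ∀ β ∈ p.support, β ≠ α → gt α β

/-- The ordering `>_ω`: first compare `ω`-weighted degrees, then break ties by `>`. -/
def weightedOrdering {n : ℕ} (ω : Fin n → ℕ) (gt : (Fin n → ℕ) → (Fin n → ℕ) → Prop)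
    (α β : Fin n → ℕ) : Prop :=
  wdeg ω β < wdeg ω α ∨ (wdeg ω α = wdeg ω β ∧ gt α β)

/-- The weight vector `ω̃ = (ω, 1)`. -/
def homWeight {n : ℕ} (ω : Fin n → ℕ) : Fin (n + 1) → ℕ := Fin.snoc (α := fun _ => ℕ) ω 1

/-- The ordering `>_ω^h` on exponents `(α, d) ∈ ℕⁿ × ℕ = ℕⁿ⁺¹`: first compare `ω̃`-weighted degrees,
then compare the `α`-parts by `>_ω`. -/
def homOrdering {n : ℕ} (ω : Fin n → ℕ) (gt : (Fin n → ℕ) → (Fin n → ℕ) → Prop)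
    (a b : Fin (n + 1) → ℕ) : Prop :=
  wdeg (homWeight ω) b < wdeg (homWeight ω) a ∨
    (wdeg (homWeight ω) a = wdeg (homWeight ω) b ∧
      weightedOrdering ω gt (Fin.init (α := fun _ => ℕ) a) (Fin.init (α := fun _ => ℕ) b))

/-! ### G-algebras -/

/-- The data of commutation relations `x_j x_i = c_ij x_i x_j + d_ij`, `i < j`. Only the values at
pairs `i < j` are ever used. -/
structure Relations (K : Type*) [Field K] (n : ℕ) where
  c : Fin n → Fin n → K
  d : Fin n → Fin n → StdPoly K n

namespace Relations

variable {K : Type*} [Field K] {n : ℕ}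

/-- The relations identify `x_j x_i` with `c_ij x_i x_j + d_ij`, for `i < j`. -/
inductive Rel (D : Relations K n) : FreeAlg K n → FreeAlg K n → Prop
  | comm (i j : Fin n) (hij : i < j) :
      Rel D (fvar K j * fvar K i) (D.c i j • (fvar K i * fvar K j) + stdToFree (D.d i j))

/-- The algebra `K⟨x₁, …, xₙ | x_j x_i = c_ij x_i x_j + d_ij, i < j⟩`. -/
abbrev Alg (D : Relations K n) : Type _ := RingQuot D.Rel

/-- The class of `x_i` in the algebra. -/
def var (D : Relations K n) (i : Fin n) : D.Alg := RingQuot.mkAlgHom K D.Rel (fvar K i)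

/-- The class of a standard polynomial in the algebra. -/
def std (D : Relations K n) : StdPoly K n →ₗ[K] D.Alg :=
  (RingQuot.mkAlgHom K D.Rel).toLinearMap ∘ₗ stdToFree

/-- One reduction step with respect to the relations, seen as rewriting rules
`x_j x_i → c_ij x_i x_j + d_ij` (`i < j`): a word `u x_j x_i v` that occurs in `f` is replaced,
together with its coefficient, by `u (c_ij x_i x_j + d_ij) v`. -/
inductive Step (D : Relations K n) : FreeAlg K n → FreeAlg K n → Prop
  | mk (f : FreeAlg K n) (u v : FreeMonoid (Fin n)) (i j : Fin n) (hij : i < j)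
      (hf : f.coeff (u * FreeMonoid.of j * FreeMonoid.of i * v) ≠ 0) :
      Step D f (f - f.coeff (u * FreeMonoid.of j * FreeMonoid.of i * v) •
        (MonoidAlgebra.of K (FreeMonoid (Fin n)) u *
          (fvar K j * fvar K i - (D.c i j • (fvar K i * fvar K j) + stdToFree (D.d i j))) *
          MonoidAlgebra.of K (FreeMonoid (Fin n)) v))

/-- `f` reduces to zero with respect to the relations, in finitely many steps. -/
def ReducesToZero (D : Relations K n) (f : FreeAlg K n) : Prop :=
  Relation.ReflTransGen D.Step f 0

/-- `c_ik c_jk d_ij x_k - x_k d_ij + c_jk x_j d_ik - c_ij d_ik x_j + d_jk x_i - c_ij c_ik x_i d_jk`,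
which comes from the overlap `x_k x_j x_i`. -/
def overlap (D : Relations K n) (i j k : Fin n) : FreeAlg K n :=
  (D.c i k * D.c j k) • (stdToFree (D.d i j) * fvar K k) - fvar K k * stdToFree (D.d i j)
    + D.c j k • (fvar K j * stdToFree (D.d i k)) - D.c i j • (stdToFree (D.d i k) * fvar K j)
    + stdToFree (D.d j k) * fvar K i - (D.c i j * D.c i k) • (fvar K i * stdToFree (D.d j k))

/-- `>` is an admissible ordering: a monomial ordering with `d_ij = 0` or
`ε_i + ε_j > exp(d_ij)`, for all `i < j`. -/
def IsAdmissible (D : Relations K n) (gt : (Fin n → ℕ) → (Fin n → ℕ) → Prop) : Prop :=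
  IsMonomialOrdering gt ∧ ∀ i j : Fin n, i < j →
    D.d i j = 0 ∨ ∃ α, IsLeadingExponent gt (D.d i j) α ∧ gt (eps i + eps j) α

/-- The relations present a G-algebra. -/
structure IsGAlgebra (D : Relations K n) : Prop where
  c_ne_zero : ∀ i j : Fin n, i < j → D.c i j ≠ 0
  exists_admissible : ∃ gt, D.IsAdmissible gt
  overlap_reduces : ∀ i j k : Fin n, i < j → j < k → D.ReducesToZero (D.overlap i j k)

/-- The relations are homogeneous for the nonzero weight vector `ω`: each `c_ij x_i x_j + d_ij` is
`ω`-homogeneous. -/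
def IsGradedBy (D : Relations K n) (ω : Fin n → ℕ) : Prop :=
  ω ≠ 0 ∧ ∀ i j : Fin n, i < j → ∀ α ∈ (D.d i j).support, ω i + ω j = wdeg ω α

/-- The `ω`-homogeneous elements of degree `d`: those `∑ c_α x^α` with `|α|_ω = d` whenever
`c_α ≠ 0`. (In a G-algebra the representation by a standard polynomial is unique.) -/
def homogeneousPart (D : Relations K n) (ω : Fin n → ℕ) (d : ℕ) : Submodule K D.Alg :=
  (Finsupp.supported K K {α : Fin n → ℕ | wdeg ω α = d}).map D.std

/-! ### The filtration and its Rees algebra -/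

/-- `F_d A = {f ∈ A | deg_ω f ≤ d}`: those `∑ c_α x^α` with `|α|_ω ≤ d` whenever `c_α ≠ 0`.
(In a G-algebra the representation by a standard polynomial is unique.) -/
def filtration (D : Relations K n) (ω : Fin n → ℕ) (d : ℕ) : Submodule K D.Alg :=
  (Finsupp.supported K K {α : Fin n → ℕ | wdeg ω α ≤ d}).map D.std

/-- `(F_d A) t^d`, inside `A[t]` (where `t` is central). -/
def reesPiece (D : Relations K n) (ω : Fin n → ℕ) (d : ℕ) : Submodule K (Polynomial D.Alg) :=
  (D.filtration ω d).map ((Polynomial.monomial d).restrictScalars K)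

/-- The Rees algebra of the `ω`-filtration: the subalgebra of `A[t]` generated by the
`(F_d A) t^d`. That it is the direct sum of these subspaces is part of what is claimed. -/
def reesAlgebra (D : Relations K n) (ω : Fin n → ℕ) : Subalgebra K (Polynomial D.Alg) :=
  Algebra.adjoin K (⋃ d, (D.reesPiece ω d : Set (Polynomial D.Alg)))

/-- `(F_d A) t^d`, as a subspace of the Rees algebra. -/
def reesGrading (D : Relations K n) (ω : Fin n → ℕ) (d : ℕ) : Submodule K (D.reesAlgebra ω) :=
  (D.reesPiece ω d).comap (D.reesAlgebra ω).val.toLinearMap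

/-- `∑ c_α x^α ↦ ∑ c_α x̃^α t^(m - |α|_ω)`; used only for `|α|_ω ≤ m`. The last of the `n + 1`
indeterminates is `t`. -/
def homogenize (ω : Fin n → ℕ) (m : ℕ) (p : StdPoly K n) : StdPoly K (n + 1) :=
  p.mapDomain fun α => Fin.snoc (α := fun _ => ℕ) α (m - wdeg ω α)

/-- The relations `x̃_j x̃_i = c_ij x̃_i x̃_j + d̃_ij` (`i < j`) and `t x̃_i = x̃_i t` in the
indeterminates `x̃₁, …, x̃ₙ, t`, where `d̃_ij = ∑ c_α^(ij) x̃^α t^(ω_i + ω_j - |α|_ω)`. -/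
def rees (D : Relations K n) (ω : Fin n → ℕ) : Relations K (n + 1) where
  c := Fin.snoc (α := fun _ => Fin (n + 1) → K)
    (fun i => Fin.snoc (α := fun _ => K) (fun j => D.c i j) 1) (fun _ => 1)
  d := Fin.snoc (α := fun _ => Fin (n + 1) → StdPoly K (n + 1))
    (fun i => Fin.snoc (α := fun _ => StdPoly K (n + 1))
      (fun j => homogenize ω (ω i + ω j) (D.d i j)) 0) (fun _ => 0)

end Relations

end GAlg

end

/-! Let `Φ` be the homomorphism x̃_i ↦ x_i t^ω_i, t ↦ t from the free algebra in x̃₁, …, x̃ₙ, t to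
polynomials in t over the free algebra in the x_i (`weightHom`). It turns each new relator into a
power of t times an old one, or into 0, so it induces a map from the presented algebra to A[t]
(`reesHom`). A standard monomial x̃^α t^e goes to x^α t^(|α|_ω + e). These images are exactly the
x^α t^d with |α|_ω ≤ d, each obtained once, and they form a basis of the sum of the (F_d A) t^d.

Injectivity needs only that standard monomials span the presented algebra, which follows from an
admissible ordering (`std_surjective`), and that they are independent in A (`exists_normalForm`).
The latter is the diamond lemma: a linear map built from one chosen reduction per word is shown, by
induction on words, to respect all reductions. Two reductions of a word are at the same place, at
disjoint places, or form an overlap x_k x_j x_i, and the last case is what condition (2) settles.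

Admissibility is a degree count. The new relations are ω̃-homogeneous, so the tie in ω̃-degree is
broken by the strict inequality ω_i + ω_j > |α|_ω.

Condition (2) for the new relations asks for actual rewriting to zero. The rules t x̃_i → x̃_i t
move every t to the right, and the resulting form depends only on the image under `Φ`
(`reflTransGen_homFree`). A reduction of an old overlap then lifts step by step: apply the
homogenized rule and move the t's to the right again (`reflTransGen_homFree_of_step`). -/

noncomputable section

namespace GAlg

open FreeMonoid (of)

/-! ### Words, their exponents, and standard words -/

/-- The exponent vector of a word: how often each letter occurs. -/
def exponent {n : ℕ} (w : FreeMonoid (Fin n)) : Fin n → ℕ := fun i => w.toList.count i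

theorem exponent_one {n : ℕ} : exponent (1 : FreeMonoid (Fin n)) = 0 := by
  ext i; simp [exponent]

theorem exponent_mul {n : ℕ} (u v : FreeMonoid (Fin n)) :
    exponent (u * v) = exponent u + exponent v := by
  ext i; simp [exponent, FreeMonoid.toList_mul, List.count_append]

theorem exponent_of {n : ℕ} (i : Fin n) : exponent (of i) = eps i := by
  ext k
  rcases eq_or_ne k i with rfl | h
  · simp [exponent, eps]
  · simp [exponent, eps, h, h.symm]

/-- The exponent vector as a monoid homomorphism. -/
def exponentHom (n : ℕ) : FreeMonoid (Fin n) →* Multiplicative (Fin n → ℕ) where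
  toFun w := Multiplicative.ofAdd (exponent w)
  map_one' := by rw [exponent_one]; rfl
  map_mul' u v := by rw [exponent_mul]; rfl

theorem exponent_stdWord {n : ℕ} (α : Fin n → ℕ) : exponent (stdWord α) = α := by
  have h : exponentHom n (stdWord α) = ∏ i, Multiplicative.ofAdd (α i • eps i) := by
    rw [stdWord, map_list_prod, List.map_ofFn, List.prod_ofFn]
    refine Finset.prod_congr rfl fun i _ => ?_
    simp only [Function.comp_apply, map_pow, ofAdd_nsmul]
    congr 1
    exact congrArg Multiplicative.ofAdd (exponent_of i)
  have h2 : exponent (stdWord α) = ∑ i, α i • eps i := by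
    have := congrArg Multiplicative.toAdd h
    rw [toAdd_prod] at this
    exact this
  rw [h2]
  ext k
  simp [eps, Pi.single_apply]

theorem pairwise_stdWord {n : ℕ} (α : Fin n → ℕ) : (stdWord α).toList.Pairwise (· ≤ ·) := by
  have hpow : ∀ (i : Fin n) (k : ℕ), (of i ^ k).toList = List.replicate k i := by
    intro i k
    induction k with
    | zero => rfl
    | succ k ih => rw [pow_succ', FreeMonoid.toList_of_mul, ih, List.replicate_succ]
  rw [stdWord, FreeMonoid.toList_prod, List.map_ofFn, List.pairwise_flatten]
  constructor
  · intro l hl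
    obtain ⟨i, rfl⟩ := (List.mem_ofFn' _ _).1 hl
    simp only [Function.comp_apply, hpow, List.pairwise_replicate]
    exact Or.inr le_rfl
  · rw [List.pairwise_ofFn]
    intro i j hij x hx y hy
    simp only [Function.comp_apply, hpow] at hx hy
    rw [List.eq_of_mem_replicate hx, List.eq_of_mem_replicate hy]
    exact hij.le

theorem eq_stdWord_of_pairwise {n : ℕ} (w : FreeMonoid (Fin n))
    (h : w.toList.Pairwise (· ≤ ·)) : w = stdWord (exponent w) := by
  apply FreeMonoid.toList.injective
  refine List.Perm.eq_of_pairwise (fun a b _ _ => le_antisymm) h (pairwise_stdWord _) ?_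
  rw [List.perm_iff_count]
  intro i
  exact (congrFun (exponent_stdWord (exponent w)) i).symm

/-- A word contains a factor `x_j x_i` with `i < j`. -/
def HasInversion {n : ℕ} (w : FreeMonoid (Fin n)) : Prop :=
  ∃ (u v : FreeMonoid (Fin n)) (i j : Fin n), i < j ∧ w = u * of j * of i * v

theorem eq_stdWord_of_not_hasInversion {n : ℕ} {w : FreeMonoid (Fin n)} (h : ¬ HasInversion w) :
    w = stdWord (exponent w) := by
  apply eq_stdWord_of_pairwise
  rw [← List.isChain_iff_pairwise, List.isChain_iff_forall_rel_of_append_cons_cons]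
  intro a b l₁ l₂ hl
  by_contra hab
  exact h ⟨FreeMonoid.ofList l₁, FreeMonoid.ofList l₂, b, a, not_le.1 hab, by
    apply FreeMonoid.toList.injective
    simp [hl, FreeMonoid.toList_mul]⟩

theorem not_hasInversion_stdWord {n : ℕ} (α : Fin n → ℕ) : ¬ HasInversion (stdWord α) := by
  rintro ⟨u, v, i, j, hij, hw⟩
  have h := pairwise_stdWord α
  rw [hw] at h
  simp only [FreeMonoid.toList_mul, FreeMonoid.toList_of, List.append_assoc] at h
  have := (List.pairwise_append.1 h).2.1
  simp only [List.singleton_append, List.pairwise_cons, List.mem_cons] at this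
  exact absurd (this.1 i (Or.inl rfl)) (not_le.2 hij)

/-- The sum of the letters of a list, weighted by the number of letters to their right. -/
def swapMeasureList {n : ℕ} : List (Fin n) → ℕ
  | [] => 0
  | a :: l => a * l.length + swapMeasureList l

/-- A measure on words that drops when a factor `x_j x_i`, `i < j`, is sorted. -/
def swapMeasure {n : ℕ} (w : FreeMonoid (Fin n)) : ℕ := swapMeasureList w.toList

/-- Letters of `u` and `v` keep the number of letters to their right, while the swap moves one unit
of weight from `j` to `i`, a drop of `j - i`. -/
theorem swapMeasure_swap_lt {n : ℕ} (u v : FreeMonoid (Fin n)) {i j : Fin n} (hij : i < j) :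
    swapMeasure (u * of i * of j * v) < swapMeasure (u * of j * of i * v) := by
  simp only [swapMeasure, FreeMonoid.toList_mul, FreeMonoid.toList_of, List.append_assoc,
    List.cons_append, List.nil_append]
  induction u.toList with
  | nil =>
    simp only [List.nil_append, swapMeasureList, List.length_cons]
    have : (i : ℕ) < j := hij
    nlinarith
  | cons a l ih =>
    simp only [List.cons_append, swapMeasureList, List.length_append, List.length_cons] at ih ⊢
    omega

/-- The ordering of words by exponent vector and then by `swapMeasure`. -/
def wordLT {n : ℕ} (gt : (Fin n → ℕ) → (Fin n → ℕ) → Prop) (w w' : FreeMonoid (Fin n)) : Prop :=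
  gt (exponent w') (exponent w) ∨ exponent w = exponent w' ∧ swapMeasure w < swapMeasure w'

section

variable {n : ℕ} {gt : (Fin n → ℕ) → (Fin n → ℕ) → Prop}

theorem IsMonomialOrdering.add_both (h : IsMonomialOrdering gt) {α β : Fin n → ℕ} (hab : gt α β)
    (γ δ : Fin n → ℕ) : gt (γ + α + δ) (γ + β + δ) := by
  rw [add_comm γ α, add_comm γ β, add_assoc, add_assoc]
  exact h.add_right _ _ _ hab

theorem wellFounded_wordLT (h : IsMonomialOrdering gt) : WellFounded (wordLT gt) := by
  have hwf : WellFounded (Prod.Lex (fun α β : Fin n → ℕ => gt β α) (fun a b : ℕ => a < b)) :=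
    WellFounded.prod_lex h.wf wellFounded_lt
  refine Subrelation.wf ?_ (InvImage.wf (fun w => (exponent w, swapMeasure w)) hwf)
  rintro w w' (h1 | ⟨h1, h2⟩)
  · exact Prod.Lex.left _ _ h1
  · change Prod.Lex _ _ (exponent w, swapMeasure w) (exponent w', swapMeasure w')
    rw [h1]
    exact Prod.Lex.right _ h2

theorem wordLT_of_gt (h : IsMonomialOrdering gt) (u v : FreeMonoid (Fin n))
    {w w' : FreeMonoid (Fin n)} (hw : gt (exponent w') (exponent w)) :
    wordLT gt (u * w * v) (u * w' * v) := by
  left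
  simp only [exponent_mul]
  exact h.add_both hw _ _

theorem wordLT_swap (gt : (Fin n → ℕ) → (Fin n → ℕ) → Prop) (u v : FreeMonoid (Fin n))
    {i j : Fin n} (hij : i < j) :
    wordLT gt (u * of i * of j * v) (u * of j * of i * v) := by
  right
  refine ⟨?_, swapMeasure_swap_lt u v hij⟩
  simp only [exponent_mul]
  abel

theorem wdeg_add (ω α β : Fin n → ℕ) : wdeg ω (α + β) = wdeg ω α + wdeg ω β := by
  simp [wdeg, mul_add, Finset.sum_add_distrib]

theorem wdeg_eps (ω : Fin n → ℕ) (i : Fin n) : wdeg ω (eps i) = ω i := by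
  simp [wdeg, eps, Pi.single_apply]

theorem wdeg_zero (ω : Fin n → ℕ) : wdeg ω 0 = 0 := by
  simp [wdeg]

end

/-! ### Normal forms -/

/-- A word, as an element of the free algebra. -/
abbrev word (K : Type*) [Field K] {n : ℕ} (w : FreeMonoid (Fin n)) : FreeAlg K n :=
  MonoidAlgebra.of K (FreeMonoid (Fin n)) w

section

variable {K : Type*} [Field K] {n : ℕ}

theorem word_mul (u v : FreeMonoid (Fin n)) : word K (u * v) = word K u * word K v := map_mul _ _ _

theorem stdToFree_single (α : Fin n → ℕ) :
    stdToFree (Finsupp.single α (1 : K)) = word K (stdWord α) := by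
  simp [stdToFree]

theorem stdToFree_eq_sum (p : StdPoly K n) :
    stdToFree p = ∑ α ∈ p.support, p α • word K (stdWord α) := rfl

theorem word_mem_supported {S : Set (FreeMonoid (Fin n))} {w : FreeMonoid (Fin n)} (h : w ∈ S) :
    word K w ∈ MonoidAlgebra.supported K K S := by
  rw [MonoidAlgebra.supported_eq_span_single]
  exact Submodule.subset_span ⟨w, h, rfl⟩

theorem supported_le {S : Set (FreeMonoid (Fin n))} {M : Submodule K (FreeAlg K n)}
    (h : ∀ w ∈ S, word K w ∈ M) : MonoidAlgebra.supported K K S ≤ M := by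
  rw [MonoidAlgebra.supported_eq_span_single, Submodule.span_le]
  rintro _ ⟨w, hw, rfl⟩
  exact h w hw

theorem span_word (M : Submodule K (FreeAlg K n)) (h : ∀ w, word K w ∈ M) (f : FreeAlg K n) :
    f ∈ M :=
  supported_le (S := Set.univ) (fun w _ => h w) (by rw [MonoidAlgebra.mem_supported]; simp)

theorem mul_stdToFree_mul (f g : FreeAlg K n) (p : StdPoly K n) :
    f * stdToFree p * g = ∑ α ∈ p.support, p α • (f * word K (stdWord α) * g) := by
  simp only [stdToFree_eq_sum, Finset.mul_sum, Finset.sum_mul, mul_smul_comm, smul_mul_assoc]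

theorem wordLT_trans {gt : (Fin n → ℕ) → (Fin n → ℕ) → Prop} (h : IsMonomialOrdering gt)
    {a b c : FreeMonoid (Fin n)} (hab : wordLT gt a b) (hbc : wordLT gt b c) : wordLT gt a c := by
  rcases hab with h1 | ⟨h1, h1'⟩ <;> rcases hbc with h2 | ⟨h2, h2'⟩
  · exact Or.inl (h.trans _ _ _ h2 h1)
  · exact Or.inl (h2 ▸ h1)
  · exact Or.inl (h1 ▸ h2)
  · exact Or.inr ⟨h1.trans h2, h1'.trans h2'⟩

/-- The words that are smaller than `W` in all contexts. -/
def wordsBelow (gt : (Fin n → ℕ) → (Fin n → ℕ) → Prop) (W : FreeMonoid (Fin n)) :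
    Set (FreeMonoid (Fin n)) := {w | ∀ a b, wordLT gt (a * w * b) (a * W * b)}

theorem mem_wordsBelow_of_gt {gt : (Fin n → ℕ) → (Fin n → ℕ) → Prop} (h : IsMonomialOrdering gt)
    {w W : FreeMonoid (Fin n)} (hw : gt (exponent W) (exponent w)) : w ∈ wordsBelow gt W :=
  fun a b => wordLT_of_gt h a b hw

theorem mem_wordsBelow_swap (gt : (Fin n → ℕ) → (Fin n → ℕ) → Prop) (u v : FreeMonoid (Fin n))
    {i j : Fin n} (hij : i < j) :
    u * of i * of j * v ∈ wordsBelow gt (u * of j * of i * v) := by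
  intro a b
  have := wordLT_swap gt (a * u) (v * b) hij
  simpa only [mul_assoc] using this

/-- Stability under multiplication is built into the quantification over contexts in `wordsBelow`,
so nothing is needed about `swapMeasure` of general words. -/
theorem mul_mem_wordsBelow {gt : (Fin n → ℕ) → (Fin n → ℕ) → Prop} {w W : FreeMonoid (Fin n)}
    (h : w ∈ wordsBelow gt W) (u v : FreeMonoid (Fin n)) :
    u * w * v ∈ wordsBelow gt (u * W * v) := by
  intro a b
  simpa only [mul_assoc] using h (a * u) (v * b)

theorem wordsBelow_trans {gt : (Fin n → ℕ) → (Fin n → ℕ) → Prop} (h : IsMonomialOrdering gt)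
    {a b c : FreeMonoid (Fin n)} (hab : a ∈ wordsBelow gt b) (hbc : b ∈ wordsBelow gt c) :
    a ∈ wordsBelow gt c := fun u v => wordLT_trans h (hab u v) (hbc u v)

/-- A linear map on finite linear combinations, defined by well-founded recursion on the basis. -/
theorem exists_linearMap_of_wellFounded {W V : Type*} [AddCommGroup V] [Module K V]
    {lt : W → W → Prop} (hwf : WellFounded lt) (S : Set W) (base : W → V) (r : W → W →₀ K)
    (hr : ∀ w ∈ S, ∀ x ∈ (r w).support, lt x w) :
    ∃ N : (W →₀ K) →ₗ[K] V, (∀ w ∉ S, N (Finsupp.single w 1) = base w) ∧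
      ∀ w ∈ S, N (Finsupp.single w 1) = N (r w) := by
  classical
  let F : ∀ w, (∀ x, lt x w → V) → V := fun w rec =>
    if h : w ∈ S then ∑ x ∈ (r w).support.attach, r w x • rec x (hr w h x x.2) else base w
  refine ⟨Finsupp.linearCombination K (hwf.fix F), fun w hw => ?_, fun w hw => ?_⟩
  · rw [Finsupp.linearCombination_single, one_smul, hwf.fix_eq]
    exact dif_neg hw
  · rw [Finsupp.linearCombination_single, one_smul, hwf.fix_eq]
    refine (dif_pos hw).trans ?_
    rw [Finsupp.linearCombination_apply, Finsupp.sum,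
      Finset.sum_attach (r w).support (fun x => r w x • hwf.fix F x)]

end

/-! ### Reduction modulo the relations: spanning and a chosen reduction -/

namespace Relations

variable {K : Type*} [Field K] {n : ℕ} (D : Relations K n)

/-- The right hand side `c_ij x_i x_j + d_ij` of a relation. -/
def rhs (i j : Fin n) : FreeAlg K n := D.c i j • (fvar K i * fvar K j) + stdToFree (D.d i j)

/-- The relator `x_j x_i - (c_ij x_i x_j + d_ij)`. -/
def relator (i j : Fin n) : FreeAlg K n := fvar K j * fvar K i - D.rhs i j

/-- The class of an element of the free algebra. -/
abbrev proj : FreeAlg K n →ₐ[K] D.Alg := RingQuot.mkAlgHom K D.Rel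

theorem proj_relator {i j : Fin n} (hij : i < j) : D.proj (D.relator i j) = 0 := by
  rw [relator, map_sub, sub_eq_zero]
  exact RingQuot.mkAlgHom_rel K (Rel.comm i j hij)

theorem relator_context (i j : Fin n) (u v : FreeMonoid (Fin n)) :
    word K u * D.relator i j * word K v =
      word K (u * of j * of i * v) - word K u * D.rhs i j * word K v := by
  simp only [relator, mul_sub, sub_mul, word_mul, fvar, mul_assoc]

variable {D} {gt : (Fin n → ℕ) → (Fin n → ℕ) → Prop}

theorem IsAdmissible.gt_of_mem_support (h : D.IsAdmissible gt) {i j : Fin n} (hij : i < j)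
    {α : Fin n → ℕ} (hα : α ∈ (D.d i j).support) : gt (eps i + eps j) α := by
  rcases h.2 i j hij with h0 | ⟨β, hβ, hgt⟩
  · simp [h0] at hα
  · rcases eq_or_ne α β with rfl | hne
    · exact hgt
    · exact h.1.trans _ _ _ hgt (hβ.2 α hα hne)

/-- The term x_i x_j has the same exponent as x_j x_i and is smaller by `swapMeasure`; the monomials
of d_ij already have a smaller exponent. -/
theorem IsAdmissible.rhs_mem (h : D.IsAdmissible gt) {i j : Fin n} (hij : i < j) :
    D.rhs i j ∈ MonoidAlgebra.supported K K (wordsBelow gt (of j * of i)) := by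
  refine add_mem (Submodule.smul_mem _ _ ?_) ?_
  · have := word_mem_supported (K := K) (mem_wordsBelow_swap gt 1 1 hij)
    rw [one_mul, one_mul, mul_one, mul_one, word_mul] at this
    exact this
  · rw [stdToFree_eq_sum]
    refine Submodule.sum_mem _ fun α hα => Submodule.smul_mem _ _ (word_mem_supported ?_)
    apply mem_wordsBelow_of_gt h.1
    rw [exponent_mul, exponent_of, exponent_of, exponent_stdWord, add_comm]
    exact h.gt_of_mem_support hij hα

theorem mul_mem_supported_wordsBelow {f : FreeAlg K n} {W : FreeMonoid (Fin n)}
    (h : f ∈ MonoidAlgebra.supported K K (wordsBelow gt W)) (u v : FreeMonoid (Fin n)) :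
    word K u * f * word K v ∈ MonoidAlgebra.supported K K (wordsBelow gt (u * W * v)) := by
  have hle : MonoidAlgebra.supported K K (wordsBelow gt W) ≤
      (MonoidAlgebra.supported K K (wordsBelow gt (u * W * v))).comap
        (LinearMap.mulRight K (word K v) ∘ₗ LinearMap.mulLeft K (word K u)) := by
    apply supported_le
    intro w hw
    have := word_mem_supported (K := K) (mul_mem_wordsBelow hw u v)
    rw [word_mul, word_mul] at this
    exact this
  exact hle h

theorem supported_mono_wordsBelow (h : IsMonomialOrdering gt) {w W : FreeMonoid (Fin n)}
    (hw : w ∈ wordsBelow gt W) : MonoidAlgebra.supported K K (wordsBelow gt w) ≤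
      MonoidAlgebra.supported K K (wordsBelow gt W) :=
  MonoidAlgebra.supported_mono fun _ hx => wordsBelow_trans h hx hw

theorem filtration_mono {ω : Fin n → ℕ} {a b : ℕ} (hab : a ≤ b) :
    D.filtration ω a ≤ D.filtration ω b :=
  Submodule.map_mono (Finsupp.supported_mono fun _ hγ => le_trans hγ hab)

/-- The class of a word of weight `d` lies in `F_d`, provided that the relations do not increase
the weight. -/
theorem IsAdmissible.proj_word_mem_filtration (h : D.IsAdmissible gt) {ω : Fin n → ℕ}
    (hω : ∀ i j : Fin n, i < j → ∀ α ∈ (D.d i j).support, wdeg ω α ≤ ω i + ω j)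
    (w : FreeMonoid (Fin n)) : D.proj (word K w) ∈ D.filtration ω (wdeg ω (exponent w)) := by
  induction w using (wellFounded_wordLT h.1).induction with
  | _ w ih =>
    by_cases hw : HasInversion w
    · obtain ⟨u, v, i, j, hij, rfl⟩ := hw
      have key : D.proj (word K (u * of j * of i * v)) = D.proj (word K u * D.rhs i j * word K v) := by
        rw [← sub_eq_zero, ← map_sub, ← relator_context, map_mul, map_mul, D.proj_relator hij,
          mul_zero, zero_mul]
      rw [key, rhs, mul_add, add_mul, map_add]
      refine add_mem ?_ ?_
      · have h1 := ih _ (wordLT_swap gt u v hij)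
        have h2 : exponent (u * of i * of j * v) = exponent (u * of j * of i * v) := by
          simp only [exponent_mul]; abel
        rw [h2] at h1
        rw [mul_smul_comm, smul_mul_assoc, map_smul]
        refine Submodule.smul_mem _ _ ?_
        simpa only [fvar, word_mul, mul_assoc] using h1
      · rw [mul_stdToFree_mul, map_sum]
        refine Submodule.sum_mem _ fun α hα => ?_
        rw [map_smul]
        refine Submodule.smul_mem _ _ ?_
        have h1 := ih (u * stdWord α * v) (by
          have := wordLT_of_gt h.1 u v (w := stdWord α) (w' := of j * of i) (by
            rw [exponent_mul, exponent_of, exponent_of, exponent_stdWord, add_comm]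
            exact h.gt_of_mem_support hij hα)
          simpa only [mul_assoc] using this)
        rw [word_mul, word_mul] at h1
        refine filtration_mono ?_ h1
        have := hω i j hij α hα
        simp only [exponent_mul, exponent_of, exponent_stdWord, wdeg_add, wdeg_eps]
        omega
    · refine ⟨Finsupp.single (exponent w) 1, ?_, ?_⟩
      · exact Finsupp.single_mem_supported _ _ (le_refl (wdeg ω (exponent w)))
      · conv_rhs => rw [eq_stdWord_of_not_hasInversion hw]
        rw [← stdToFree_single]; rfl

theorem IsAdmissible.std_surjective (h : D.IsAdmissible gt) : Function.Surjective D.std := by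
  intro x
  obtain ⟨f, rfl⟩ := RingQuot.mkAlgHom_surjective K D.Rel x
  -- For the weight 0 the filtration statement says only that every word is congruent to a standard
  -- polynomial.
  have := span_word ((LinearMap.range D.std).comap D.proj.toLinearMap) (fun w => by
    obtain ⟨p, -, hp⟩ := h.proj_word_mem_filtration (ω := 0) (by simp [wdeg]) w
    exact ⟨p, hp⟩) f
  exact this

/-- A linear form of reduction: a map that is invariant under one chosen reduction of every
reducible word. -/
theorem IsAdmissible.exists_reduction (h : D.IsAdmissible gt) :
    ∃ N : FreeAlg K n →ₗ[K] StdPoly K n,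
      (∀ α, N (word K (stdWord α)) = Finsupp.single α 1) ∧
      ∀ w, HasInversion w → ∃ (u v : FreeMonoid (Fin n)) (i j : Fin n), i < j ∧
        w = u * of j * of i * v ∧ N (word K u * D.relator i j * word K v) = 0 := by
  classical
  have hr : ∀ w : FreeMonoid (Fin n), ∃ r : FreeAlg K n, HasInversion w →
      (∀ x ∈ r.coeff.support, wordLT gt x w) ∧
      ∃ (u v : FreeMonoid (Fin n)) (i j : Fin n), i < j ∧
        w = u * of j * of i * v ∧ r = word K u * D.rhs i j * word K v := by
    intro w
    by_cases hw : HasInversion w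
    · obtain ⟨u, v, i, j, hij, rfl⟩ := hw
      refine ⟨word K u * D.rhs i j * word K v, fun _ => ⟨fun x hx => ?_, u, v, i, j, hij, rfl, rfl⟩⟩
      have hmem := mul_mem_supported_wordsBelow (h.rhs_mem hij) u v
      have := MonoidAlgebra.mem_supported.1 hmem hx 1 1
      simpa only [one_mul, mul_one, mul_assoc] using this
    · exact ⟨0, fun hw' => absurd hw' hw⟩
  choose r hr using hr
  obtain ⟨N, hN1, hN2⟩ := exists_linearMap_of_wellFounded (K := K) (wellFounded_wordLT h.1)
    {w | HasInversion w} (fun w => Finsupp.single (exponent w) (1 : K)) (fun w => (r w).coeff)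
    (fun w hw => (hr w hw).1)
  refine ⟨N ∘ₗ (MonoidAlgebra.coeffLinearEquiv K).toLinearMap, fun α => ?_, fun w hw => ?_⟩
  · refine (hN1 _ (not_hasInversion_stdWord α)).trans ?_
    rw [exponent_stdWord]
  · obtain ⟨-, u, v, i, j, hij, hw', hr'⟩ := hr w hw
    refine ⟨u, v, i, j, hij, hw', ?_⟩
    rw [relator_context, map_sub, sub_eq_zero, ← hr', ← hw']
    exact hN2 w hw

end Relations

namespace Relations

variable {K : Type*} [Field K] {n : ℕ} {D : Relations K n}
  {gt : (Fin n → ℕ) → (Fin n → ℕ) → Prop}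

/-! ### Confluence -/

/-- The difference of the two reductions of `x_k x_j x_i`, in terms of relators with smaller
leading words and the overlap. -/
theorem relator_overlap (D : Relations K n) (i j k : Fin n) :
    D.relator j k * fvar K i - fvar K k * D.relator i j =
      - D.overlap i j k - D.c j k • (fvar K j * D.relator i k)
        + D.c i j • (D.relator i k * fvar K j)
        - (D.c j k * D.c i k) • (D.relator i j * fvar K k)
        + (D.c i j * D.c i k) • (fvar K i * D.relator j k) := by
  simp only [relator, rhs, overlap, mul_sub, sub_mul, mul_add, add_mul, smul_mul_assoc,
    mul_smul_comm, mul_assoc]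
  module

/-- A linear map that kills all `u (x_j x_i - c_ij x_i x_j - d_ij) v` with `u x_j x_i v < W`. -/
def KillsBelow (D : Relations K n) (gt : (Fin n → ℕ) → (Fin n → ℕ) → Prop) {V : Type*}
    [AddCommGroup V] [Module K V] (N : FreeAlg K n →ₗ[K] V) (W : FreeMonoid (Fin n)) : Prop :=
  ∀ (u v : FreeMonoid (Fin n)) (i j : Fin n), i < j → wordLT gt (u * of j * of i * v) W →
    N (word K u * D.relator i j * word K v) = 0

section

variable {V : Type*} [AddCommGroup V] [Module K V] {N : FreeAlg K n →ₗ[K] V}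

/-- A step subtracts a multiple of a relator whose leading word occurs in `f`. In the context `u`,
`v` that word lies below `u * W * v`, so `N` kills the relator; its other words are smaller still.
-/
theorem step_mem_and_apply_eq (h : D.IsAdmissible gt) {W u v : FreeMonoid (Fin n)}
    (hN : KillsBelow D gt N (u * W * v)) {f g : FreeAlg K n} (hfg : D.Step f g)
    (hf : f ∈ MonoidAlgebra.supported K K (wordsBelow gt W)) :
    g ∈ MonoidAlgebra.supported K K (wordsBelow gt W) ∧
      N (word K u * f * word K v) = N (word K u * g * word K v) := by
  obtain ⟨a, b, i, j, hij, hne⟩ := hfg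
  have hmem : a * of j * of i * b ∈ wordsBelow gt W :=
    MonoidAlgebra.mem_supported.1 hf (Finsupp.mem_support_iff.2 hne)
  change _ - _ • (word K a * D.relator i j * word K b) ∈ _ ∧
    _ = N (word K u * (_ - _ • (word K a * D.relator i j * word K b)) * word K v)
  constructor
  · refine sub_mem hf (Submodule.smul_mem _ _ ?_)
    rw [relator_context]
    refine sub_mem (word_mem_supported hmem) ?_
    have h1 := mul_mem_supported_wordsBelow (h.rhs_mem hij) a b
    exact supported_mono_wordsBelow h.1 (by simpa only [mul_assoc] using hmem) h1
  · have h1 := hN (u * a) (b * v) i j hij (by simpa only [mul_assoc] using hmem u v)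
    rw [mul_sub, sub_mul, map_sub, mul_smul_comm, smul_mul_assoc, map_smul]
    have h2 : word K u * (word K a * D.relator i j * word K b) * word K v =
        word K (u * a) * D.relator i j * word K (b * v) := by
      simp only [word_mul, mul_assoc]
    rw [h2, h1, smul_zero, sub_zero]

theorem apply_eq_zero_of_reducesToZero (h : D.IsAdmissible gt) {W u v : FreeMonoid (Fin n)}
    (hN : KillsBelow D gt N (u * W * v)) {f : FreeAlg K n} (hf0 : D.ReducesToZero f)
    (hf : f ∈ MonoidAlgebra.supported K K (wordsBelow gt W)) :
    N (word K u * f * word K v) = 0 := by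
  unfold ReducesToZero at hf0
  induction hf0 using Relation.ReflTransGen.head_induction_on with
  | refl => simp
  | head hstep _ ih =>
    obtain ⟨h1, h2⟩ := step_mem_and_apply_eq h hN hstep hf
    exact h2.trans (ih h1)

/-- The words of an overlap polynomial arise from `x_k x_j x_i` by replacing the product of two
letters by a standard monomial of `d`. -/
theorem overlap_mem_supported {i j k : Fin n} (hij : i < j) (hjk : j < k)
    {S : Set (FreeMonoid (Fin n))}
    (hS : ∀ (a b : Fin n) (u v : FreeMonoid (Fin n)), a < b →
      exponent u + (eps a + eps b) + exponent v = eps k + eps j + eps i →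
      ∀ α ∈ (D.d a b).support, u * stdWord α * v ∈ S) :
    D.overlap i j k ∈ MonoidAlgebra.supported K K S := by
  have key : ∀ (a b : Fin n) (u v : FreeMonoid (Fin n)), a < b →
      exponent u + (eps a + eps b) + exponent v = eps k + eps j + eps i →
      word K u * stdToFree (D.d a b) * word K v ∈ MonoidAlgebra.supported K K S := by
    intro a b u v hab hexp
    rw [mul_stdToFree_mul]
    refine Submodule.sum_mem _ fun α hα => Submodule.smul_mem _ _ ?_
    rw [← word_mul, ← word_mul]
    exact word_mem_supported (hS a b u v hab hexp α hα)
  have left : ∀ (a b c : Fin n), a < b → eps c + (eps a + eps b) = eps k + eps j + eps i →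
      fvar K c * stdToFree (D.d a b) ∈ MonoidAlgebra.supported K K S := by
    intro a b c hab hexp
    have := key a b (of c) 1 hab (by rw [exponent_of, exponent_one, add_zero, hexp])
    rwa [word, word, map_one, mul_one] at this
  have right : ∀ (a b c : Fin n), a < b → eps a + eps b + eps c = eps k + eps j + eps i →
      stdToFree (D.d a b) * fvar K c ∈ MonoidAlgebra.supported K K S := by
    intro a b c hab hexp
    have := key a b 1 (of c) hab (by rw [exponent_of, exponent_one, zero_add, hexp])
    rwa [word, word, map_one, one_mul] at this
  have hik := hij.trans hjk
  refine sub_mem (add_mem (sub_mem (add_mem (sub_mem (Submodule.smul_mem _ _ ?_) ?_)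
    (Submodule.smul_mem _ _ ?_)) (Submodule.smul_mem _ _ ?_)) ?_) (Submodule.smul_mem _ _ ?_)
  · exact right i j k hij (by abel)
  · exact left i j k hij (by abel)
  · exact left i k j hik (by abel)
  · exact right i k j hik (by abel)
  · exact right j k i hjk (by abel)
  · exact left j k i hjk (by abel)

theorem overlap_mem (h : D.IsAdmissible gt) {i j k : Fin n} (hij : i < j) (hjk : j < k) :
    D.overlap i j k ∈ MonoidAlgebra.supported K K (wordsBelow gt (of k * of j * of i)) := by
  refine overlap_mem_supported hij hjk fun a b u v hab hexp α hα => mem_wordsBelow_of_gt h.1 ?_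
  rw [exponent_mul, exponent_mul, exponent_mul, exponent_mul, exponent_of, exponent_of,
    exponent_of, exponent_stdWord, ← hexp]
  exact h.1.add_both (h.gt_of_mem_support hab hα) _ _

/-- The two reductions of an overlap `u x_k x_j x_i v` agree. -/
theorem apply_overlap (h : D.IsAdmissible gt) {u v : FreeMonoid (Fin n)} {i j k : Fin n}
    (hij : i < j) (hjk : j < k) (hov : D.ReducesToZero (D.overlap i j k))
    (hN : KillsBelow D gt N (u * of k * of j * of i * v)) :
    N (word K u * D.relator j k * word K (of i * v)) =
      N (word K (u * of k) * D.relator i j * word K v) := by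
  have hik := hij.trans hjk
  have hzero : N (word K u * D.overlap i j k * word K v) = 0 :=
    apply_eq_zero_of_reducesToZero h (W := of k * of j * of i)
      (by simpa only [mul_assoc] using hN) hov (overlap_mem h hij hjk)
  have kill : ∀ (a b : Fin n) (p q : FreeMonoid (Fin n)), a < b →
      wordLT gt (u * (p * of b * of a * q) * v) (u * of k * of j * of i * v) →
      N (word K u * (word K p * D.relator a b * word K q) * word K v) = 0 := by
    intro a b p q hab hlt
    have := hN (u * p) (q * v) a b hab (by simpa only [mul_assoc] using hlt)
    simpa only [word_mul, mul_assoc] using this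
  -- The leading words of the four relator terms in `relator_overlap` arise from x_k x_j x_i by
  -- sorting inversions, so all of them are smaller and `N` kills these terms.
  have swap₁ : wordLT gt (u * of j * of k * of i * v) (u * of k * of j * of i * v) := by
    simpa only [mul_assoc] using wordLT_swap gt u (of i * v) hjk
  have swap₂ : wordLT gt (u * of k * of i * of j * v) (u * of k * of j * of i * v) :=
    wordLT_swap gt (u * of k) v hij
  have swap₃ : wordLT gt (u * of j * of i * of k * v) (u * of k * of j * of i * v) :=
    wordLT_trans h.1 (wordLT_swap gt (u * of j) v hik) swap₁
  have swap₄ : wordLT gt (u * of i * of k * of j * v) (u * of k * of j * of i * v) := by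
    refine wordLT_trans h.1 ?_ swap₂
    simpa only [mul_assoc] using wordLT_swap gt u (of j * v) hik
  have k₁ := kill i k (of j) 1 hik (by simpa only [mul_assoc, one_mul, mul_one] using swap₁)
  have k₂ := kill i k 1 (of j) hik (by simpa only [mul_assoc, one_mul, mul_one] using swap₂)
  have k₃ := kill i j 1 (of k) hij (by simpa only [mul_assoc, one_mul, mul_one] using swap₃)
  have k₄ := kill j k (of i) 1 hjk (by simpa only [mul_assoc, one_mul, mul_one] using swap₄)
  have hone : word K (1 : FreeMonoid (Fin n)) = 1 := map_one _
  rw [hone, mul_one] at k₁ k₄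
  rw [hone, one_mul] at k₂ k₃
  rw [← sub_eq_zero, ← map_sub]
  have e : word K u * D.relator j k * word K (of i * v) -
      word K (u * of k) * D.relator i j * word K v =
      word K u * (D.relator j k * fvar K i - fvar K k * D.relator i j) * word K v := by
    simp only [word_mul, fvar, mul_sub, sub_mul, mul_assoc]
  rw [e, relator_overlap]
  simp only [mul_add, mul_sub, add_mul, sub_mul, mul_neg, neg_mul, mul_smul_comm, smul_mul_assoc,
    map_add, map_sub, map_neg, map_smul, hzero, neg_zero]
  change 0 - _ • N (word K u * (word K (of j) * D.relator i k) * word K v) +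
    _ • N (word K u * (D.relator i k * word K (of j)) * word K v) -
    _ • N (word K u * (D.relator i j * word K (of k)) * word K v) +
    _ • N (word K u * (word K (of i) * D.relator j k) * word K v) = 0
  rw [k₁, k₂, k₃, k₄]
  simp

/-- Reductions at disjoint positions agree. -/
theorem apply_disjoint (h : D.IsAdmissible gt) {u q v : FreeMonoid (Fin n)} {i j i' j' : Fin n}
    (hij : i < j) (hij' : i' < j')
    (hN : KillsBelow D gt N (u * of j * of i * q * of j' * of i' * v)) :
    N (word K u * D.relator i j * word K (q * of j' * of i' * v)) =
      N (word K (u * of j * of i * q) * D.relator i' j' * word K v) := by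
  -- With W = ρ + r and W' = ρ' + r' (relator plus right hand side), the difference ρ q W' - W q ρ'
  -- equals ρ q r' - r q ρ'. Both terms involve only smaller leading words.
  have h₁ : N (word K u * D.relator i j * word K q * D.rhs i' j' * word K v) = 0 := by
    have hle : MonoidAlgebra.supported K K (wordsBelow gt (of j' * of i')) ≤
        LinearMap.ker (N ∘ₗ LinearMap.mulRight K (word K v) ∘ₗ
          LinearMap.mulLeft K (word K u * D.relator i j * word K q)) := by
      apply supported_le
      intro w hw
      have := hN u (q * w * v) i j hij
        (by simpa only [mul_assoc] using hw (u * of j * of i * q) v)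
      simp only [word_mul, ← mul_assoc] at this
      exact this
    exact hle (h.rhs_mem hij')
  have h₂ : N (word K u * D.rhs i j * word K q * D.relator i' j' * word K v) = 0 := by
    have hle : MonoidAlgebra.supported K K (wordsBelow gt (of j * of i)) ≤
        LinearMap.ker (N ∘ₗ LinearMap.mulRight K (word K q * D.relator i' j' * word K v) ∘ₗ
          LinearMap.mulLeft K (word K u)) := by
      apply supported_le
      intro w hw
      have := hN (u * w * q) v i' j' hij'
        (by simpa only [mul_assoc] using hw u (q * of j' * of i' * v))
      simp only [word_mul, mul_assoc] at this
      simp only [LinearMap.mem_ker, LinearMap.comp_apply, LinearMap.mulRight_apply,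
        LinearMap.mulLeft_apply, mul_assoc]
      exact this
    have := hle (h.rhs_mem hij)
    simp only [LinearMap.mem_ker, LinearMap.comp_apply, LinearMap.mulRight_apply,
      LinearMap.mulLeft_apply] at this
    simpa only [mul_assoc] using this
  have e : word K u * D.relator i j * word K (q * of j' * of i' * v) -
      word K (u * of j * of i * q) * D.relator i' j' * word K v =
      word K u * D.relator i j * word K q * D.rhs i' j' * word K v -
        word K u * D.rhs i j * word K q * D.relator i' j' * word K v := by
    simp only [relator, word_mul, fvar, mul_sub, sub_mul, mul_assoc]
    abel
  rw [← sub_eq_zero, ← map_sub, e, map_sub, h₁, h₂, sub_zero]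

/-- The offset `p` between the two inversions decides the case: length 0 means the same inversion,
length 1 an overlap of three letters, length at least 2 disjoint factors. -/
theorem apply_eq_of_length_le (h : D.IsAdmissible gt)
    (hov : ∀ i j k : Fin n, i < j → j < k → D.ReducesToZero (D.overlap i j k))
    {u v u' v' : FreeMonoid (Fin n)} {i j i' j' : Fin n} (hij : i < j) (hij' : i' < j')
    (heq : u * of j * of i * v = u' * of j' * of i' * v')
    (hlen : u.toList.length ≤ u'.toList.length)
    (hN : KillsBelow D gt N (u * of j * of i * v)) :
    N (word K u * D.relator i j * word K v) = N (word K u' * D.relator i' j' * word K v') := by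
  have hl := congrArg FreeMonoid.toList heq
  simp only [FreeMonoid.toList_mul, FreeMonoid.toList_of, List.append_assoc, List.cons_append,
    List.nil_append] at hl
  obtain ⟨p, hp⟩ : u.toList <+: u'.toList :=
    List.prefix_of_prefix_length_le ⟨_, hl⟩ ⟨_, rfl⟩ hlen
  rw [← hp, List.append_assoc, List.append_cancel_left_eq] at hl
  have hu' : u' = u * FreeMonoid.ofList p := FreeMonoid.toList.injective hp.symm
  subst hu'
  match p, hl with
  | [], hl =>
    simp only [List.nil_append, List.cons.injEq] at hl
    obtain ⟨rfl, rfl, hv⟩ := hl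
    obtain rfl : v = v' := FreeMonoid.toList.injective hv
    simp
  | [a], hl =>
    simp only [List.cons_append, List.nil_append, List.cons.injEq] at hl
    obtain ⟨rfl, rfl, hv⟩ := hl
    obtain rfl : v = of i' * v' := FreeMonoid.toList.injective hv
    exact apply_overlap h hij' hij (hov _ _ _ hij' hij) (by simpa only [mul_assoc] using hN)
  | a :: b :: q, hl =>
    simp only [List.cons_append, List.cons.injEq] at hl
    obtain ⟨rfl, rfl, hv⟩ := hl
    obtain rfl : v = FreeMonoid.ofList q * of j' * of i' * v' := by
      apply FreeMonoid.toList.injective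
      simp [FreeMonoid.toList_mul, hv]
    have := apply_disjoint (N := N) h (u := u) (q := FreeMonoid.ofList q) (v := v') hij hij'
      (by simpa only [mul_assoc] using hN)
    rw [this, FreeMonoid.ofList_cons, FreeMonoid.ofList_cons]
    simp only [mul_assoc]

end

/-- In a G-algebra there is a linear map on the free algebra that fixes standard monomials and
kills the ideal of relations. -/
theorem IsGAlgebra.exists_normalForm_free (hD : D.IsGAlgebra) :
    ∃ N : FreeAlg K n →ₗ[K] StdPoly K n,
      (∀ α, N (word K (stdWord α)) = Finsupp.single α 1) ∧
      ∀ (u v : FreeMonoid (Fin n)) (i j : Fin n), i < j →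
        N (word K u * D.relator i j * word K v) = 0 := by
  obtain ⟨gt, h⟩ := hD.exists_admissible
  obtain ⟨N, hN1, hN2⟩ := h.exists_reduction
  refine ⟨N, hN1, ?_⟩
  have key : ∀ W : FreeMonoid (Fin n), ∀ (u v : FreeMonoid (Fin n)) (i j : Fin n), i < j →
      u * of j * of i * v = W → N (word K u * D.relator i j * word K v) = 0 := by
    intro W
    induction W using (wellFounded_wordLT h.1).induction with
    | _ W ih =>
      rintro u v i j hij rfl
      -- By induction `N` kills every reduction of a smaller word, so at this word any reduction has
      -- the same value as the chosen one, which is 0.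
      have hkill : KillsBelow D gt N (u * of j * of i * v) := fun a b k l hkl hlt =>
        ih _ hlt a b k l hkl rfl
      obtain ⟨u', v', i', j', hij', heq, hzero⟩ := hN2 _ ⟨u, v, i, j, hij, rfl⟩
      rcases le_total u.toList.length u'.toList.length with hlen | hlen
      · rw [apply_eq_of_length_le h hD.overlap_reduces hij hij' heq hlen hkill, hzero]
      · rw [← apply_eq_of_length_le h hD.overlap_reduces hij' hij heq.symm hlen (heq ▸ hkill),
          hzero]
  exact fun u v i j hij => key _ u v i j hij rfl

/-- This turns equality of classes into the equivalence generated by `RingQuot.Rel`, on which one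
can induct. -/
theorem toQuot_proj (f : FreeAlg K n) : (D.proj f).toQuot = Quot.mk _ f := by
  simp [RingQuot.mkAlgHom_def, RingQuot.mkRingHom_def]

/-- The standard monomials of a G-algebra are linearly independent: `std` has a linear left
inverse. -/
theorem IsGAlgebra.exists_normalForm (hD : D.IsGAlgebra) :
    ∃ N : D.Alg →ₗ[K] StdPoly K n, ∀ p, N (D.std p) = p := by
  obtain ⟨N, hN1, hN2⟩ := hD.exists_normalForm_free
  have hctx : ∀ (f g : FreeAlg K n) (i j : Fin n), i < j → N (f * D.relator i j * g) = 0 := by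
    intro f g i j hij
    refine span_word (LinearMap.ker (N ∘ₗ LinearMap.mulRight K g ∘ₗ
      LinearMap.mulRight K (D.relator i j))) (fun u => ?_) f
    refine span_word (LinearMap.ker (N ∘ₗ LinearMap.mulLeft K (word K u * D.relator i j)))
      (fun v => ?_) g
    exact hN2 u v i j hij
  -- The arbitrary factors `a`, `b` let the induction pass through left and right multiplication.
  have hrel : ∀ f g : FreeAlg K n, RingQuot.Rel D.Rel f g → ∀ a b, N (a * (f - g) * b) = 0 := by
    intro f g hfg
    induction hfg with
    | of hr =>
      obtain ⟨i, j, hij⟩ := hr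
      exact fun a b => hctx a b i j hij
    | add_left _ ih => intro a b; rw [add_sub_add_right_eq_sub]; exact ih a b
    | @mul_left x y c _ ih => intro a b; rw [← sub_mul, ← mul_assoc, mul_assoc]; exact ih a _
    | @mul_right x y z _ ih => intro a b; rw [← mul_sub, ← mul_assoc]; exact ih _ b
  have hproj : ∀ f g : FreeAlg K n, D.proj f = D.proj g → N f = N g := by
    intro f g hfg
    have hq := congrArg RingQuot.toQuot hfg
    rw [toQuot_proj, toQuot_proj] at hq
    have hgen := Quot.eqvGen_exact hq
    clear hq hfg
    induction hgen with
    | rel x y hxy =>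
      have := hrel x y hxy 1 1
      rwa [one_mul, mul_one, map_sub, sub_eq_zero] at this
    | refl => rfl
    | symm _ _ _ ih => exact ih.symm
    | trans _ _ _ _ _ ih₁ ih₂ => exact ih₁.trans ih₂
  -- Composing `N` with any linear section of the projection suffices: by `hproj` the value does not
  -- depend on the representative.
  obtain ⟨s, hs⟩ := LinearMap.exists_rightInverse_of_surjective D.proj.toLinearMap
    (LinearMap.range_eq_top.2 (RingQuot.mkAlgHom_surjective K D.Rel))
  refine ⟨N ∘ₗ s, fun p => ?_⟩
  have h1 : N (s (D.std p)) = N (stdToFree p) := hproj _ _ (LinearMap.congr_fun hs (D.std p))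
  rw [LinearMap.comp_apply, h1, stdToFree_eq_sum, map_sum]
  simp only [map_smul, hN1, Finsupp.smul_single, smul_eq_mul, mul_one]
  exact Finsupp.sum_single p

end Relations

section

variable {n : ℕ}

/-! ### The ordering `>_ω^h` and the weight `ω̃` -/

theorem wdeg_homWeight (ω : Fin n → ℕ) (a : Fin (n + 1) → ℕ) :
    wdeg (homWeight ω) a = wdeg ω (Fin.init (α := fun _ => ℕ) a) + a (Fin.last n) := by
  simp [wdeg, homWeight, Fin.sum_univ_castSucc, Fin.init]

theorem init_add (a b : Fin (n + 1) → ℕ) : Fin.init (α := fun _ => ℕ) (a + b) =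
    Fin.init (α := fun _ => ℕ) a + Fin.init (α := fun _ => ℕ) b := rfl

/-- The ω̃-degree of (α, d) is |α|_ω + d, so it determines d once α is known. This gives totality of
>_ω^h and later the injectivity of `reesHom`. -/
theorem eq_of_init_eq_of_wdeg_eq {ω : Fin n → ℕ} {a b : Fin (n + 1) → ℕ}
    (h : Fin.init (α := fun _ => ℕ) a = Fin.init (α := fun _ => ℕ) b)
    (hw : wdeg (homWeight ω) a = wdeg (homWeight ω) b) : a = b := by
  rw [wdeg_homWeight, wdeg_homWeight, h] at hw
  rw [← Fin.snoc_init_self (α := fun _ => ℕ) a, ← Fin.snoc_init_self (α := fun _ => ℕ) b, h,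
    Nat.add_left_cancel hw]

/-- The ordering is pulled back from a lexicographic product along α ↦ (|α|_ω, α); it is
well-founded because the weights are natural numbers. -/
theorem IsMonomialOrdering.weighted {gt : (Fin n → ℕ) → (Fin n → ℕ) → Prop}
    (h : IsMonomialOrdering gt) (ω : Fin n → ℕ) : IsMonomialOrdering (weightedOrdering ω gt) where
  irrefl α := by
    rintro (h1 | ⟨-, h1⟩)
    · exact lt_irrefl _ h1
    · exact h.irrefl _ h1
  trans α β γ := by
    rintro (h1 | ⟨h1, h1'⟩) (h2 | ⟨h2, h2'⟩)
    · exact Or.inl (h2.trans h1)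
    · exact Or.inl (h2 ▸ h1)
    · exact Or.inl (h1 ▸ h2)
    · exact Or.inr ⟨h1.trans h2, h.trans _ _ _ h1' h2'⟩
  total α β hne := by
    rcases lt_trichotomy (wdeg ω α) (wdeg ω β) with h1 | h1 | h1
    · exact Or.inr (Or.inl h1)
    · exact (h.total α β hne).imp (fun h2 => Or.inr ⟨h1, h2⟩) (fun h2 => Or.inr ⟨h1.symm, h2⟩)
    · exact Or.inl (Or.inl h1)
  add_right α β γ := by
    simp only [weightedOrdering, wdeg_add]
    rintro (h1 | ⟨h1, h1'⟩)
    · exact Or.inl (by omega)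
    · exact Or.inr ⟨by omega, h.add_right _ _ _ h1'⟩
  wf := by
    have hwf : WellFounded (Prod.Lex (fun a b : ℕ => a < b) (fun α β : Fin n → ℕ => gt β α)) :=
      WellFounded.prod_lex wellFounded_lt h.wf
    refine Subrelation.wf ?_ (InvImage.wf (fun α => (wdeg ω α, α)) hwf)
    rintro α β (h1 | ⟨h1, h2⟩)
    · exact Prod.Lex.left _ _ h1
    · change Prod.Lex _ _ (wdeg ω α, α) (wdeg ω β, β)
      rw [h1]
      exact Prod.Lex.right _ h2

theorem IsMonomialOrdering.hom {gt : (Fin n → ℕ) → (Fin n → ℕ) → Prop}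
    (h : IsMonomialOrdering gt) (ω : Fin n → ℕ) : IsMonomialOrdering (homOrdering ω gt) where
  irrefl α := by
    rintro (h1 | ⟨-, h1⟩)
    · exact lt_irrefl _ h1
    · exact (h.weighted ω).irrefl _ h1
  trans α β γ := by
    rintro (h1 | ⟨h1, h1'⟩) (h2 | ⟨h2, h2'⟩)
    · exact Or.inl (h2.trans h1)
    · exact Or.inl (h2 ▸ h1)
    · exact Or.inl (h1 ▸ h2)
    · exact Or.inr ⟨h1.trans h2, (h.weighted ω).trans _ _ _ h1' h2'⟩
  total α β hne := by
    rcases lt_trichotomy (wdeg (homWeight ω) α) (wdeg (homWeight ω) β) with h1 | h1 | h1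
    · exact Or.inr (Or.inl h1)
    · exact ((h.weighted ω).total _ _ fun h2 => hne (eq_of_init_eq_of_wdeg_eq h2 h1)).imp
        (fun h2 => Or.inr ⟨h1, h2⟩) (fun h2 => Or.inr ⟨h1.symm, h2⟩)
    · exact Or.inl (Or.inl h1)
  add_right α β γ := by
    simp only [homOrdering, wdeg_add, init_add]
    rintro (h1 | ⟨h1, h1'⟩)
    · exact Or.inl (by omega)
    · exact Or.inr ⟨by omega, (h.weighted ω).add_right _ _ _ h1'⟩
  wf := by
    have hwf : WellFounded (Prod.Lex (fun a b : ℕ => a < b)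
        (fun α β : Fin n → ℕ => weightedOrdering ω gt β α)) :=
      WellFounded.prod_lex wellFounded_lt (h.weighted ω).wf
    refine Subrelation.wf ?_ (InvImage.wf (fun α : Fin (n + 1) → ℕ =>
      (wdeg (homWeight ω) α, Fin.init (α := fun _ => ℕ) α)) hwf)
    rintro α β (h1 | ⟨h1, h2⟩)
    · exact Prod.Lex.left _ _ h1
    · change Prod.Lex _ _ (wdeg (homWeight ω) α, _) (wdeg (homWeight ω) β, _)
      rw [h1]
      exact Prod.Lex.right _ h2

theorem IsMonomialOrdering.exists_isLeadingExponent {K : Type*} [Field K]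
    {gt : (Fin n → ℕ) → (Fin n → ℕ) → Prop} (h : IsMonomialOrdering gt) {p : StdPoly K n}
    (hp : p ≠ 0) : ∃ α, IsLeadingExponent gt p α := by
  classical
  have key : ∀ s : Finset (Fin n → ℕ), s.Nonempty → ∃ α ∈ s, ∀ β ∈ s, β ≠ α → gt α β := by
    intro s hs
    induction hs using Finset.Nonempty.cons_induction with
    | singleton a => exact ⟨a, by simp⟩
    | cons a s ha _ ih =>
      obtain ⟨α, hα, hmax⟩ := ih
      have hne : α ≠ a := fun h1 => ha (h1 ▸ hα)
      rcases h.total α a hne with h1 | h1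
      · refine ⟨α, by simp [hα], fun β hβ hβα => ?_⟩
        rcases Finset.mem_cons.1 hβ with rfl | hβ
        · exact h1
        · exact hmax β hβ hβα
      · refine ⟨a, by simp, fun β hβ hβa => ?_⟩
        have hβ := (Finset.mem_cons.1 hβ).resolve_left hβa
        rcases eq_or_ne β α with rfl | hβα
        · exact h1
        · exact h.trans _ _ _ h1 (hmax β hβ hβα)
  exact key p.support (Finsupp.support_nonempty_iff.2 hp)

theorem homWeight_castSucc (ω : Fin n → ℕ) (i : Fin n) : homWeight ω i.castSucc = ω i := by
  simp [homWeight]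

theorem homWeight_last (ω : Fin n → ℕ) : homWeight ω (Fin.last n) = 1 := by
  simp [homWeight]

end

namespace Relations

variable {K : Type*} [Field K] {n : ℕ} {D : Relations K n} {ω : Fin n → ℕ}

/-! ### The homogenized relations: grading and admissible ordering -/

theorem rees_c_castSucc (i j : Fin n) : (D.rees ω).c i.castSucc j.castSucc = D.c i j := by
  simp [rees]

theorem rees_c_last (i : Fin n) : (D.rees ω).c i.castSucc (Fin.last n) = 1 := by
  simp [rees]

theorem rees_d_castSucc (i j : Fin n) :
    (D.rees ω).d i.castSucc j.castSucc = homogenize ω (ω i + ω j) (D.d i j) := by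
  simp [rees]

theorem rees_d_last (i : Fin n) : (D.rees ω).d i.castSucc (Fin.last n) = 0 := by
  simp [rees]

/-- To prove a property of pairs `i < j` in `Fin (n + 1)`, treat `j = Fin.last n` separately. -/
theorem forall_lt_succ {P : Fin (n + 1) → Fin (n + 1) → Prop}
    (h1 : ∀ i j : Fin n, i < j → P i.castSucc j.castSucc)
    (h2 : ∀ i : Fin n, P i.castSucc (Fin.last n)) (i j : Fin (n + 1)) (hij : i < j) : P i j := by
  induction i using Fin.lastCases with
  | last => exact absurd hij (not_lt.2 (Fin.le_last j))
  | cast i =>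
    induction j using Fin.lastCases with
    | last => exact h2 i
    | cast j => exact h1 i j (Fin.castSucc_lt_castSucc_iff.1 hij)

theorem exists_of_mem_support_homogenize {m : ℕ} {p : StdPoly K n} {β : Fin (n + 1) → ℕ}
    (h : β ∈ (homogenize ω m p).support) :
    ∃ α ∈ p.support, β = Fin.snoc (α := fun _ => ℕ) α (m - wdeg ω α) := by
  classical
  obtain ⟨α, hα, rfl⟩ := Finset.mem_image.1 (Finsupp.mapDomain_support h)
  exact ⟨α, hα, rfl⟩

/-- The power of t in d̃_ij fills the gap between |α|_ω and ω_i + ω_j; by `hω` the truncated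
subtraction is exact. -/
theorem isGradedBy_rees
    (hω : ∀ i j : Fin n, i < j → ∀ α ∈ (D.d i j).support, wdeg ω α ≤ ω i + ω j) :
    (D.rees ω).IsGradedBy (homWeight ω) := by
  refine ⟨fun h => ?_, forall_lt_succ (fun i j hij β hβ => ?_) (fun i β hβ => ?_)⟩
  · have := congrFun h (Fin.last n)
    rw [homWeight_last] at this
    exact one_ne_zero this
  · rw [rees_d_castSucc] at hβ
    obtain ⟨α, hα, rfl⟩ := exists_of_mem_support_homogenize hβ
    have := hω i j hij α hα
    rw [wdeg_homWeight, homWeight_castSucc, homWeight_castSucc, Fin.init_snoc, Fin.snoc_last]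
    omega
  · simp [rees_d_last] at hβ

/-- Homogeneity makes the ω̃-degrees equal, and the strict inequality in `hω` then decides the
comparison before `gt` is consulted. Hence any monomial ordering `gt` will do. -/
theorem isAdmissible_rees
    (hω : ∀ i j : Fin n, i < j → ∀ α ∈ (D.d i j).support, wdeg ω α < ω i + ω j)
    {gt : (Fin n → ℕ) → (Fin n → ℕ) → Prop} (h : IsMonomialOrdering gt) :
    (D.rees ω).IsAdmissible (homOrdering ω gt) := by
  refine ⟨h.hom ω, forall_lt_succ (fun i j hij => ?_) (fun i => Or.inl (rees_d_last i))⟩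
  by_cases h0 : (D.rees ω).d i.castSucc j.castSucc = 0
  · exact Or.inl h0
  obtain ⟨β, hβ⟩ := (h.hom ω).exists_isLeadingExponent h0
  refine Or.inr ⟨β, hβ, Or.inr ⟨?_, Or.inl ?_⟩⟩
  · rw [wdeg_add, wdeg_eps, wdeg_eps]
    exact (isGradedBy_rees fun i j hij α hα => (hω i j hij α hα).le).2 _ _
      (Fin.castSucc_lt_castSucc_iff.2 hij) β hβ.1
  · have hβ' := hβ.1
    rw [rees_d_castSucc] at hβ'
    obtain ⟨α, hα, rfl⟩ := exists_of_mem_support_homogenize hβ'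
    have e : ∀ k : Fin n, Fin.init (α := fun _ => ℕ) (eps k.castSucc) = eps k := by
      intro k
      ext l
      simp [Fin.init, eps, Pi.single_apply]
    rw [Fin.init_snoc, init_add, e, e, wdeg_add, wdeg_eps, wdeg_eps]
    exact hω i j hij α hα

/-! ### From the free algebra in `x̃₁, …, x̃ₙ, t` to polynomials over the free algebra -/

/-- The homomorphism `x̃_i ↦ x_i t^ω_i`, `t ↦ t`. -/
def weightHom (K : Type*) [Field K] (ω : Fin n → ℕ) :
    FreeAlg K (n + 1) →ₐ[K] Polynomial (FreeAlg K n) :=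
  MonoidAlgebra.lift K (Polynomial (FreeAlg K n)) (FreeMonoid (Fin (n + 1)))
    (FreeMonoid.lift (Fin.snoc (α := fun _ => Polynomial (FreeAlg K n))
      (fun i => Polynomial.monomial (ω i) (fvar K i)) Polynomial.X))

/-- The inclusion of words. -/
def embed : FreeMonoid (Fin n) →* FreeMonoid (Fin (n + 1)) := FreeMonoid.map Fin.castSucc

theorem embed_of (i : Fin n) : embed (of i) = of i.castSucc := rfl

theorem weightHom_fvar_castSucc (i : Fin n) :
    weightHom K ω (fvar K i.castSucc) = Polynomial.monomial (ω i) (fvar K i) := by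
  simp [weightHom, fvar]

theorem weightHom_fvar_last : weightHom K ω (fvar K (Fin.last n)) = Polynomial.X := by
  simp [weightHom, fvar]

theorem weightHom_embed (w : FreeMonoid (Fin n)) :
    weightHom K ω (word K (embed w)) = Polynomial.monomial (wdeg ω (exponent w)) (word K w) := by
  induction w using FreeMonoid.inductionOn' with
  | one => rw [map_one, exponent_one, wdeg_zero, word, word, map_one, map_one, map_one]; rfl
  | of_mul i w ih =>
    rw [map_mul, word_mul, map_mul, ih, word_mul, exponent_mul, exponent_of, wdeg_add, wdeg_eps,
      ← Polynomial.monomial_mul_monomial, embed_of]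
    congr 1
    exact weightHom_fvar_castSucc i

theorem weightHom_embed_mul (w : FreeMonoid (Fin n)) (d : ℕ) :
    weightHom K ω (word K (embed w * of (Fin.last n) ^ d)) =
      Polynomial.monomial (wdeg ω (exponent w) + d) (word K w) := by
  have h : weightHom K ω (word K (of (Fin.last n) ^ d)) = Polynomial.monomial d 1 := by
    rw [word, map_pow, map_pow, ← Polynomial.X_pow_eq_monomial]
    congr 1
    exact weightHom_fvar_last
  rw [word_mul, map_mul, weightHom_embed, h, Polynomial.monomial_mul_monomial, mul_one]

theorem stdWord_succ (β : Fin (n + 1) → ℕ) :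
    stdWord β = embed (stdWord (Fin.init (α := fun _ => ℕ) β)) *
      of (Fin.last n) ^ β (Fin.last n) := by
  rw [stdWord, List.ofFn_succ', List.concat_eq_append, List.prod_append, List.prod_singleton,
    stdWord, map_list_prod, List.map_ofFn]
  have h : (embed ∘ fun i => of i ^ Fin.init (α := fun _ => ℕ) β i) =
      fun i : Fin n => of i.castSucc ^ β i.castSucc :=
    funext fun i => map_pow embed (of i) _
  rw [h]

/-- The power of t in the image is the ω̃-degree, so the ω̃-grading corresponds to the grading by
powers of t. -/
theorem weightHom_stdWord (β : Fin (n + 1) → ℕ) :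
    weightHom K ω (word K (stdWord β)) = Polynomial.monomial (wdeg (homWeight ω) β)
      (word K (stdWord (Fin.init (α := fun _ => ℕ) β))) := by
  rw [stdWord_succ, weightHom_embed_mul, exponent_stdWord, wdeg_homWeight]

theorem weightHom_homogenize {m : ℕ} {p : StdPoly K n} (hp : ∀ α ∈ p.support, wdeg ω α ≤ m) :
    weightHom K ω (stdToFree (homogenize ω m p)) = Polynomial.monomial m (stdToFree p) := by
  have h : (weightHom K ω) (stdToFree (homogenize ω m p)) = ∑ α ∈ p.support, p α •
      weightHom K ω (word K (stdWord (Fin.snoc (α := fun _ => ℕ) α (m - wdeg ω α)))) := by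
    rw [homogenize, Finsupp.mapDomain, Finsupp.sum, map_sum, map_sum]
    refine Finset.sum_congr rfl fun α _ => ?_
    rw [← map_smul, ← stdToFree_single, ← map_smul, Finsupp.smul_single, smul_eq_mul, mul_one]
  rw [h, stdToFree_eq_sum, map_sum]
  refine Finset.sum_congr rfl fun α hα => ?_
  rw [weightHom_stdWord, wdeg_homWeight, Fin.init_snoc, Fin.snoc_last,
    Nat.add_sub_of_le (hp α hα), Polynomial.smul_monomial]

theorem weightHom_rhs_castSucc {i j : Fin n}
    (hω : ∀ α ∈ (D.d i j).support, wdeg ω α ≤ ω i + ω j) :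
    weightHom K ω ((D.rees ω).rhs i.castSucc j.castSucc) =
      Polynomial.monomial (ω i + ω j) (D.rhs i j) := by
  rw [rhs, rees_c_castSucc, rees_d_castSucc, map_add, map_smul, map_mul,
    weightHom_homogenize hω, weightHom_fvar_castSucc, weightHom_fvar_castSucc,
    Polynomial.monomial_mul_monomial, Polynomial.smul_monomial, ← map_add]
  rfl

theorem weightHom_fvar_mul_castSucc (i j : Fin n) :
    weightHom K ω (fvar K j.castSucc * fvar K i.castSucc) =
      Polynomial.monomial (ω i + ω j) (fvar K j * fvar K i) := by
  rw [map_mul, weightHom_fvar_castSucc, weightHom_fvar_castSucc,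
    Polynomial.monomial_mul_monomial, add_comm]

theorem weightHom_relator_castSucc {i j : Fin n}
    (hω : ∀ α ∈ (D.d i j).support, wdeg ω α ≤ ω i + ω j) :
    weightHom K ω ((D.rees ω).relator i.castSucc j.castSucc) =
      Polynomial.monomial (ω i + ω j) (D.relator i j) := by
  rw [relator, map_sub, weightHom_rhs_castSucc hω, weightHom_fvar_mul_castSucc, ← map_sub]
  rfl

theorem rhs_last (i : Fin n) : (D.rees ω).rhs i.castSucc (Fin.last n) =
    fvar K i.castSucc * fvar K (Fin.last n) := by
  rw [rhs, rees_c_last, rees_d_last, map_zero, add_zero, one_smul]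

theorem relator_last (i : Fin n) : (D.rees ω).relator i.castSucc (Fin.last n) =
    fvar K (Fin.last n) * fvar K i.castSucc - fvar K i.castSucc * fvar K (Fin.last n) := by
  rw [relator, rhs_last]

theorem weightHom_relator_last (i : Fin n) :
    weightHom K ω ((D.rees ω).relator i.castSucc (Fin.last n)) = 0 := by
  rw [relator_last, map_sub, map_mul, map_mul, weightHom_fvar_last, Polynomial.X_mul, sub_self]

theorem weightHom_overlap_castSucc
    (hω : ∀ i j : Fin n, i < j → ∀ α ∈ (D.d i j).support, wdeg ω α ≤ ω i + ω j)
    {i j k : Fin n} (hij : i < j) (hjk : j < k) :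
    weightHom K ω ((D.rees ω).overlap i.castSucc j.castSucc k.castSucc) =
      Polynomial.monomial (ω i + ω j + ω k) (D.overlap i j k) := by
  have e₁ : ω k + (ω i + ω j) = ω i + ω j + ω k := by omega
  have e₂ : ω j + (ω i + ω k) = ω i + ω j + ω k := by omega
  have e₃ : ω i + ω k + ω j = ω i + ω j + ω k := by omega
  have e₄ : ω j + ω k + ω i = ω i + ω j + ω k := by omega
  have e₅ : ω i + (ω j + ω k) = ω i + ω j + ω k := by omega
  simp only [overlap, rees_c_castSucc, rees_d_castSucc, map_sub, map_add, map_smul, map_mul,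
    weightHom_homogenize (hω i j hij), weightHom_homogenize (hω j k hjk),
    weightHom_homogenize (hω i k (hij.trans hjk)), weightHom_fvar_castSucc,
    Polynomial.monomial_mul_monomial, Polynomial.smul_monomial, e₁, e₂, e₃, e₄, e₅]

/-- With t as the third letter only d̃_ij t - t d̃_ij survives, and t is central in the image. -/
theorem weightHom_overlap_last (i j : Fin n) :
    weightHom K ω ((D.rees ω).overlap i.castSucc j.castSucc (Fin.last n)) = 0 := by
  simp only [overlap, rees_c_last, rees_d_last, map_sub, map_mul, map_zero,
    weightHom_fvar_last, mul_zero, zero_mul, smul_zero, add_zero, sub_zero, mul_one, one_smul,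
    Polynomial.X_mul, sub_self]

end Relations

namespace Relations

variable {K : Type*} [Field K] {n : ℕ} {D : Relations K n} {ω : Fin n → ℕ}

/-! ### Homogenization of elements of the free algebra, and lifting of reductions -/

/-- Homogenization of words: `w ↦ w t^(m - deg w)`. -/
def homWord (ω : Fin n → ℕ) (m : ℕ) (w : FreeMonoid (Fin n)) : FreeMonoid (Fin (n + 1)) :=
  embed w * of (Fin.last n) ^ (m - wdeg ω (exponent w))

/-- Homogenization of elements of the free algebra, in degree `m`. -/
def homFree (K : Type*) [Field K] (ω : Fin n → ℕ) (m : ℕ) : FreeAlg K n →ₗ[K] FreeAlg K (n + 1) :=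
  MonoidAlgebra.mapDomainLinearMap K K (homWord ω m)

theorem homFree_word (m : ℕ) (w : FreeMonoid (Fin n)) :
    homFree K ω m (word K w) = word K (homWord ω m w) :=
  MonoidAlgebra.mapDomainLinearMap_single _ _ _

theorem homWord_injective (ω : Fin n → ℕ) (m : ℕ) : Function.Injective (homWord ω m) := by
  -- Deleting every t recovers the word.
  let strip : FreeMonoid (Fin (n + 1)) →* FreeMonoid (Fin n) :=
    FreeMonoid.lift (Fin.snoc (α := fun _ => FreeMonoid (Fin n)) of 1)
  have hembed : strip.comp embed = MonoidHom.id _ := by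
    refine FreeMonoid.hom_eq fun i => ?_
    simp [strip, embed_of]
  refine Function.LeftInverse.injective (g := strip) fun w => ?_
  have h1 : strip (embed w) = w := DFunLike.congr_fun hembed w
  have h2 : strip (of (Fin.last n)) = 1 := by simp [strip]
  rw [homWord, map_mul, h1, map_pow, h2, one_pow, mul_one]

/-- A `Step` replaces a word together with its whole coefficient, so lifting steps requires that no
two words merge under homogenization. -/
theorem coeff_homFree (m : ℕ) (f : FreeAlg K n) (w : FreeMonoid (Fin n)) :
    (homFree K ω m f).coeff (homWord ω m w) = f.coeff w := by
  rw [homFree, MonoidAlgebra.coeff_mapDomainLinearMap]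
  exact Finsupp.mapDomain_apply (homWord_injective ω m) _ _

theorem weightHom_homFree {m : ℕ} {f : FreeAlg K n}
    (hf : f ∈ MonoidAlgebra.supported K K {w | wdeg ω (exponent w) ≤ m}) :
    weightHom K ω (homFree K ω m f) = Polynomial.monomial m f := by
  have hle : MonoidAlgebra.supported K K {w : FreeMonoid (Fin n) | wdeg ω (exponent w) ≤ m} ≤
      LinearMap.eqLocus ((weightHom K ω).toLinearMap ∘ₗ homFree K ω m)
        ((Polynomial.monomial m).restrictScalars K) := by
    apply supported_le
    intro w hw
    change weightHom K ω (homFree K ω m (word K w)) = Polynomial.monomial m (word K w)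
    rw [homFree_word, homWord, weightHom_embed_mul, Nat.add_sub_of_le hw]
  exact hle hf

/-- The element of the free algebra in `x̃₁, …, x̃ₙ, t`, with all `t` to the right, that
corresponds to a polynomial. -/
def rehom (K : Type*) [Field K] (ω : Fin n → ℕ) :
    Polynomial (FreeAlg K n) →+ FreeAlg K (n + 1) where
  toFun q := q.sum fun d g => homFree K ω d g
  map_zero' := Polynomial.sum_zero_index _
  map_add' p q := Polynomial.sum_add_index p q _ (fun _ => map_zero _) (fun _ _ _ => map_add _ _ _)

theorem rehom_monomial (m : ℕ) (g : FreeAlg K n) :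
    rehom K ω (Polynomial.monomial m g) = homFree K ω m g :=
  Polynomial.sum_monomial_index _ _ (map_zero _)

/-- The words in which no `t` stands directly to the left of an `x̃_i` are the `w t^d`. -/
theorem exists_eq_embed_mul_or (w : FreeMonoid (Fin (n + 1))) :
    (∃ (w' : FreeMonoid (Fin n)) (d : ℕ), w = embed w' * of (Fin.last n) ^ d) ∨
      ∃ (u v : FreeMonoid (Fin (n + 1))) (i : Fin n), w = u * of (Fin.last n) * of i.castSucc * v := by
  induction w using FreeMonoid.inductionOn' with
  | one => exact Or.inl ⟨1, 0, by simp⟩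
  | of_mul a w ih =>
    rcases ih with ⟨w', d, rfl⟩ | ⟨u, v, i, rfl⟩
    · induction a using Fin.lastCases with
      | cast i => exact Or.inl ⟨of i * w', d, by rw [map_mul, embed_of, mul_assoc]⟩
      | last =>
        cases w' using FreeMonoid.casesOn with
        | one => exact Or.inl ⟨1, d + 1, by rw [map_one, one_mul, one_mul, pow_succ']⟩
        | of_mul i w' =>
          refine Or.inr ⟨1, embed w' * of (Fin.last n) ^ d, i, ?_⟩
          rw [map_mul, embed_of]
          simp only [mul_assoc, one_mul]
    · exact Or.inr ⟨of a * u, v, i, by simp only [mul_assoc]⟩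

theorem step_relator {m : ℕ} (E : Relations K m) (f : FreeAlg K m) (u v : FreeMonoid (Fin m))
    {i j : Fin m} (hij : i < j) (hf : f.coeff (u * of j * of i * v) ≠ 0) :
    E.Step f (f - f.coeff (u * of j * of i * v) • (word K u * E.relator i j * word K v)) :=
  Step.mk f u v i j hij hf

/-- The word w t^d goes to w in degree deg w + d, from which d can be recovered. -/
theorem rehom_weightHom {f : FreeAlg K (n + 1)} (hf : ∀ x ∈ f.coeff.support,
    ∃ (w' : FreeMonoid (Fin n)) (d : ℕ), x = embed w' * of (Fin.last n) ^ d) :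
    rehom K ω (weightHom K ω f) = f := by
  have hsum : f = ∑ x ∈ f.coeff.support, f.coeff x • word K x := by
    conv_lhs => rw [← MonoidAlgebra.sum_coeff_single f]
    refine Finset.sum_congr rfl fun x _ => ?_
    simp [word]
  conv_rhs => rw [hsum]
  conv_lhs => rw [hsum]
  rw [map_sum, map_sum]
  refine Finset.sum_congr rfl fun x hx => ?_
  obtain ⟨w, d, rfl⟩ := hf x hx
  rw [map_smul, weightHom_embed_mul, Polynomial.smul_monomial, rehom_monomial, map_smul,
    homFree_word, homWord, Nat.add_sub_cancel_left]

/-- Moving all `t` to the right is a sequence of reductions. -/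
theorem reflTransGen_rehom (f : FreeAlg K (n + 1)) :
    Relation.ReflTransGen (D.rees ω).Step f (rehom K ω (weightHom K ω f)) := by
  classical
  induction hN : ∑ w ∈ f.coeff.support, swapMeasure w using Nat.strong_induction_on generalizing f
    with
  | _ N ih =>
    by_cases hf : ∀ x ∈ f.coeff.support,
        ∃ (w' : FreeMonoid (Fin n)) (d : ℕ), x = embed w' * of (Fin.last n) ^ d
    · rw [rehom_weightHom hf]
    · push Not at hf
      obtain ⟨x, hx, hne⟩ := hf
      obtain ⟨u, v, i, rfl⟩ := (exists_eq_embed_mul_or x).resolve_left fun ⟨w', d, h⟩ => hne w' d h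
      have hstep := step_relator (D.rees ω) f u v (Fin.castSucc_lt_last i)
        (Finsupp.mem_support_iff.1 hx)
      set a := f.coeff (u * of (Fin.last n) * of i.castSucc * v) with ha
      set g := f - a • (word K u * (D.rees ω).relator i.castSucc (Fin.last n) * word K v) with hg
      set x := u * of (Fin.last n) * of i.castSucc * v with hxdef
      set y := u * of i.castSucc * of (Fin.last n) * v with hydef
      have hg' : g = f - a • (word K x - word K y) := by
        rw [hg, relator_last, hxdef, hydef]
        simp only [mul_sub, sub_mul, word_mul, fvar, mul_assoc]
      -- The target of the reduction is unchanged by the step, since t is central in the image.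
      have hΦ : weightHom K ω g = weightHom K ω f := by
        rw [hg, map_sub, map_smul, map_mul, map_mul, weightHom_relator_last, mul_zero, zero_mul,
          smul_zero, sub_zero]
      have hlt : swapMeasure y < swapMeasure x := swapMeasure_swap_lt u v (Fin.castSucc_lt_last i)
      have hxy : x ≠ y := fun h => hlt.ne (by rw [h])
      -- The step removes `x` and may add only the smaller word `y`, so the sum of `swapMeasure`
      -- over the support drops, even if `y` was present or cancels.
      have hsupp : g.coeff.support ⊆ insert y (f.coeff.support.erase x) := by
        intro z hz
        rw [Finsupp.mem_support_iff, hg'] at hz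
        by_cases hzy : z = y
        · exact Finset.mem_insert.2 (Or.inl hzy)
        have hz' : f.coeff z - a * (Finsupp.single x (1 : K) z - Finsupp.single y (1 : K) z) ≠ 0 :=
          hz
        rw [Finsupp.single_eq_of_ne hzy, sub_zero] at hz'
        refine Finset.mem_insert.2 (Or.inr (Finset.mem_erase.2 ⟨?_, ?_⟩))
        · rintro rfl
          rw [Finsupp.single_eq_same, mul_one] at hz'
          exact hz' (sub_self _)
        · rw [Finsupp.mem_support_iff]
          intro hfz
          by_cases hzx : z = x
          · subst hzx
            exact (Finsupp.mem_support_iff.1 hx) hfz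
          · rw [Finsupp.single_eq_of_ne hzx, hfz, mul_zero, sub_zero] at hz'
            exact hz' rfl
      have hsum : ∑ w ∈ g.coeff.support, swapMeasure w < N := by
        calc ∑ w ∈ g.coeff.support, swapMeasure w
            ≤ ∑ w ∈ insert y (f.coeff.support.erase x), swapMeasure w :=
              Finset.sum_le_sum_of_subset hsupp
          _ ≤ swapMeasure y + ∑ w ∈ f.coeff.support.erase x, swapMeasure w := by
              by_cases hy : y ∈ f.coeff.support.erase x
              · rw [Finset.insert_eq_of_mem hy]
                exact Nat.le_add_left _ _
              · rw [Finset.sum_insert hy]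
          _ < swapMeasure x + ∑ w ∈ f.coeff.support.erase x, swapMeasure w := by omega
          _ = N := by rw [Finset.add_sum_erase _ _ hx, hN]
      have := ih _ hsum g rfl
      rw [hΦ] at this
      exact Relation.ReflTransGen.head hstep this

/-- To find the form with all t's on the right it is enough to compute an image under `weightHom`;
the positions of the t's need not be tracked. -/
theorem reflTransGen_homFree {f : FreeAlg K (n + 1)} {m : ℕ} {g : FreeAlg K n}
    (h : weightHom K ω f = Polynomial.monomial m g) :
    Relation.ReflTransGen (D.rees ω).Step f (homFree K ω m g) := by
  have := reflTransGen_rehom (D := D) (ω := ω) f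
  rwa [h, rehom_monomial] at this

/-- Reductions lift to reductions of homogenizations. -/
theorem reflTransGen_homFree_of_step
    (hω : ∀ i j : Fin n, i < j → ∀ α ∈ (D.d i j).support, wdeg ω α ≤ ω i + ω j)
    {m : ℕ} {f g : FreeAlg K n} (hfg : D.Step f g)
    (hf : f ∈ MonoidAlgebra.supported K K {w | wdeg ω (exponent w) ≤ m}) :
    Relation.ReflTransGen (D.rees ω).Step (homFree K ω m f) (homFree K ω m g) ∧
      g ∈ MonoidAlgebra.supported K K {w | wdeg ω (exponent w) ≤ m} := by
  obtain ⟨u, v, i, j, hij, hne⟩ := hfg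
  have hW : wdeg ω (exponent (u * of j * of i * v)) ≤ m :=
    MonoidAlgebra.mem_supported.1 hf (Finsupp.mem_support_iff.2 hne)
  have hdeg : wdeg ω (exponent u) + (ω i + ω j) + wdeg ω (exponent v) =
      wdeg ω (exponent (u * of j * of i * v)) := by
    simp only [exponent_mul, exponent_of, wdeg_add, wdeg_eps]
    omega
  change Relation.ReflTransGen _ _
    (homFree K ω m (f - _ • (word K u * D.relator i j * word K v))) ∧
      f - _ • (word K u * D.relator i j * word K v) ∈ _
  set a := f.coeff (u * of j * of i * v) with ha
  constructor
  · set s := m - wdeg ω (exponent (u * of j * of i * v)) with hs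
    have hword : homWord ω m (u * of j * of i * v) =
        embed u * of j.castSucc * of i.castSucc * (embed v * of (Fin.last n) ^ s) := by
      rw [homWord, ← hs, map_mul, map_mul, map_mul, embed_of, embed_of, mul_assoc]
    have hcoeff := coeff_homFree (ω := ω) m f (u * of j * of i * v)
    rw [hword, ← ha] at hcoeff
    have hstep := step_relator (D.rees ω) (homFree K ω m f) (embed u)
      (embed v * of (Fin.last n) ^ s) (Fin.castSucc_lt_castSucc_iff.2 hij) (hcoeff ▸ hne)
    rw [hcoeff] at hstep
    -- The lifted step leaves powers of t from d̃_ij in front of `v`. Moving them to the right gives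
    -- the homogenization of the reduced element, as its image under `weightHom` shows.
    refine Relation.ReflTransGen.head hstep (reflTransGen_homFree ?_)
    rw [map_sub, map_smul, map_mul, map_mul, weightHom_homFree hf, weightHom_embed,
      weightHom_embed_mul, weightHom_relator_castSucc (hω i j hij),
      Polynomial.monomial_mul_monomial, Polynomial.monomial_mul_monomial,
      Polynomial.smul_monomial, ← add_assoc, hdeg, hs, Nat.add_sub_of_le hW, ← map_sub]
  · refine sub_mem hf (Submodule.smul_mem _ _ ?_)
    rw [relator_context]
    refine sub_mem (word_mem_supported hW) ?_
    rw [rhs, mul_add, add_mul, mul_smul_comm, smul_mul_assoc, mul_stdToFree_mul]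
    refine add_mem (Submodule.smul_mem _ _ ?_) (Submodule.sum_mem _ fun α hα =>
      Submodule.smul_mem _ _ ?_)
    · have : u * of i * of j * v ∈ {w : FreeMonoid (Fin n) | wdeg ω (exponent w) ≤ m} := by
        refine le_trans (le_of_eq ?_) hW
        simp only [exponent_mul, exponent_of, wdeg_add, wdeg_eps]
        omega
      have := word_mem_supported (K := K) this
      simp only [word_mul] at this
      rw [← mul_assoc]
      exact this
    · rw [← word_mul, ← word_mul]
      refine word_mem_supported (le_trans ?_ hW)
      have := hω i j hij α hα
      simp only [exponent_mul, exponent_of, exponent_stdWord, wdeg_add, wdeg_eps]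
      omega

theorem reflTransGen_homFree_zero
    (hω : ∀ i j : Fin n, i < j → ∀ α ∈ (D.d i j).support, wdeg ω α ≤ ω i + ω j)
    {m : ℕ} {f : FreeAlg K n} (hf0 : D.ReducesToZero f)
    (hf : f ∈ MonoidAlgebra.supported K K {w | wdeg ω (exponent w) ≤ m}) :
    Relation.ReflTransGen (D.rees ω).Step (homFree K ω m f) 0 := by
  unfold ReducesToZero at hf0
  induction hf0 using Relation.ReflTransGen.head_induction_on with
  | refl => rw [map_zero]
  | head hstep _ ih =>
    obtain ⟨h1, h2⟩ := reflTransGen_homFree_of_step hω hstep hf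
    exact h1.trans (ih h2)

/-- Only the largest index can be t. In that case moving the t's to the right already gives 0;
otherwise it gives the homogenized old overlap, whose reduction lifts. -/
theorem reducesToZero_overlap_rees
    (hω : ∀ i j : Fin n, i < j → ∀ α ∈ (D.d i j).support, wdeg ω α ≤ ω i + ω j)
    (hov : ∀ i j k : Fin n, i < j → j < k → D.ReducesToZero (D.overlap i j k))
    (i j k : Fin (n + 1)) (hij : i < j) (hjk : j < k) :
    (D.rees ω).ReducesToZero ((D.rees ω).overlap i j k) := by
  obtain ⟨j, rfl⟩ := Fin.exists_castSucc_eq.2 (hjk.trans_le (Fin.le_last k)).ne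
  obtain ⟨i, rfl⟩ := Fin.exists_castSucc_eq.2 (hij.trans_le (Fin.le_last _)).ne
  rw [Fin.castSucc_lt_castSucc_iff] at hij
  induction k using Fin.lastCases with
  | last =>
    have h : weightHom K ω ((D.rees ω).overlap i.castSucc j.castSucc (Fin.last n)) =
        Polynomial.monomial 0 0 := by rw [weightHom_overlap_last, map_zero]
    have := reflTransGen_homFree (D := D) h
    rwa [map_zero] at this
  | cast k =>
    rw [Fin.castSucc_lt_castSucc_iff] at hjk
    refine (reflTransGen_homFree (weightHom_overlap_castSucc hω hij hjk)).trans
      (reflTransGen_homFree_zero hω (hov i j k hij hjk) (overlap_mem_supported hij hjk ?_))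
    intro a b u v hab hexp α hα
    have h1 := hω a b hab α hα
    have h2 := congrArg (wdeg ω) hexp
    simp only [wdeg_add, wdeg_eps] at h2
    simp only [Set.mem_ofPred_eq, exponent_mul, exponent_stdWord, wdeg_add]
    omega

theorem IsGAlgebra.rees (hD : D.IsGAlgebra)
    (hω : ∀ i j : Fin n, i < j → ∀ α ∈ (D.d i j).support, wdeg ω α < ω i + ω j) :
    (D.rees ω).IsGAlgebra where
  c_ne_zero := forall_lt_succ
    (fun i j hij => by rw [rees_c_castSucc]; exact hD.c_ne_zero i j hij)
    (fun i => by rw [rees_c_last]; exact one_ne_zero)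
  exists_admissible := by
    obtain ⟨gt, h⟩ := hD.exists_admissible
    exact ⟨_, isAdmissible_rees hω h.1⟩
  overlap_reduces := reducesToZero_overlap_rees (fun i j hij α hα => (hω i j hij α hα).le)
    hD.overlap_reduces

end Relations

namespace Relations

variable {K : Type*} [Field K] {n : ℕ} {D : Relations K n} {ω : Fin n → ℕ}

/-! ### The presentation of the Rees algebra -/

/-- The homomorphism from the presented algebra to `A[t]`, `x̃_i ↦ x_i t^ω_i`, `t ↦ t`. -/
def reesHom (D : Relations K n) (ω : Fin n → ℕ)
    (hω : ∀ i j : Fin n, i < j → ∀ α ∈ (D.d i j).support, wdeg ω α ≤ ω i + ω j) :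
    (D.rees ω).Alg →ₐ[K] Polynomial D.Alg :=
  RingQuot.liftAlgHom K ⟨(Polynomial.mapAlgHom D.proj).comp (weightHom K ω), by
    rintro _ _ ⟨i, j, hij⟩
    change Polynomial.mapAlgHom D.proj (weightHom K ω (fvar K j * fvar K i)) =
      Polynomial.mapAlgHom D.proj (weightHom K ω ((D.rees ω).rhs i j))
    revert i j
    refine forall_lt_succ (fun i j hij => ?_) (fun i => ?_)
    · rw [weightHom_rhs_castSucc (hω i j hij), weightHom_fvar_mul_castSucc,
        Polynomial.mapAlgHom_monomial, Polynomial.mapAlgHom_monomial]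
      exact congrArg _ (RingQuot.mkAlgHom_rel K (Rel.comm i j hij))
    · rw [rhs_last, map_mul (weightHom K ω), map_mul (weightHom K ω), weightHom_fvar_last,
        Polynomial.X_mul]⟩

section

variable (hω : ∀ i j : Fin n, i < j → ∀ α ∈ (D.d i j).support, wdeg ω α ≤ ω i + ω j)

theorem reesHom_proj (f : FreeAlg K (n + 1)) :
    D.reesHom ω hω ((D.rees ω).proj f) = Polynomial.mapAlgHom D.proj (weightHom K ω f) :=
  RingQuot.liftAlgHom_mkAlgHom_apply _ _ _ _

theorem std_single (D : Relations K n) (α : Fin n → ℕ) :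
    D.std (Finsupp.single α 1) = D.proj (word K (stdWord α)) := by
  rw [← stdToFree_single]; rfl

theorem reesHom_std_single (β : Fin (n + 1) → ℕ) :
    D.reesHom ω hω ((D.rees ω).std (Finsupp.single β 1)) =
      Polynomial.monomial (wdeg (homWeight ω) β)
        (D.std (Finsupp.single (Fin.init (α := fun _ => ℕ) β) 1)) := by
  rw [std_single, reesHom_proj, weightHom_stdWord, Polynomial.mapAlgHom_monomial, std_single]

theorem filtration_eq_span (D : Relations K n) (ω : Fin n → ℕ) (d : ℕ) : D.filtration ω d =
    Submodule.span K ((fun α => D.std (Finsupp.single α 1)) '' {α | wdeg ω α ≤ d}) := by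
  rw [filtration, Finsupp.supported_eq_span_single, Submodule.map_span, Set.image_image]

/-- Monomials x̃^α t^e with |α|_ω + e = d correspond to the α with |α|_ω ≤ d, through e = d - |α|_ω.
-/
theorem map_homogeneousPart (d : ℕ) :
    ((D.rees ω).homogeneousPart (homWeight ω) d).map (D.reesHom ω hω).toLinearMap =
      D.reesPiece ω d := by
  rw [reesPiece, filtration_eq_span, homogeneousPart, Finsupp.supported_eq_span_single,
    Submodule.map_span, Submodule.map_span, Submodule.map_span, Set.image_image, Set.image_image,
    Set.image_image]
  congr 1
  ext x
  constructor
  · rintro ⟨β, hβ, rfl⟩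
    refine ⟨Fin.init (α := fun _ => ℕ) β, ?_, ?_⟩
    · have : wdeg (homWeight ω) β = d := hβ
      rw [wdeg_homWeight] at this
      exact this ▸ Nat.le_add_right _ _
    · refine Eq.trans ?_ (reesHom_std_single hω β).symm
      rw [show wdeg (homWeight ω) β = d from hβ]
      rfl
  · rintro ⟨α, hα, rfl⟩
    have h : wdeg (homWeight ω) (Fin.snoc (α := fun _ => ℕ) α (d - wdeg ω α)) = d := by
      rw [wdeg_homWeight, Fin.init_snoc, Fin.snoc_last]
      exact Nat.add_sub_of_le hα
    refine ⟨_, h, ?_⟩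
    refine (reesHom_std_single hω _).trans ?_
    rw [h, Fin.init_snoc]
    rfl

/-- Each coefficient of a standard polynomial can be read off its image: the index β is determined
by the power of t and by the exponent in A. Independence is used in A only; the presented algebra
contributes just spanning. -/
theorem reesHom_injective (hD : D.IsGAlgebra) {gt : (Fin (n + 1) → ℕ) → (Fin (n + 1) → ℕ) → Prop}
    (h : (D.rees ω).IsAdmissible gt) : Function.Injective (D.reesHom ω hω) := by
  classical
  obtain ⟨N, hN⟩ := hD.exists_normalForm
  have hcoeff : ∀ (p : StdPoly K (n + 1)) (β : Fin (n + 1) → ℕ),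
      N ((D.reesHom ω hω ((D.rees ω).std p)).coeff (wdeg (homWeight ω) β))
        (Fin.init (α := fun _ => ℕ) β) = p β := by
    intro p β
    induction p using Finsupp.induction_linear with
    | zero => simp
    | add p q hp hq =>
      rw [map_add, map_add, Polynomial.coeff_add, map_add, Finsupp.add_apply, hp, hq,
        Finsupp.add_apply]
    | single γ a =>
      have ha : Finsupp.single γ a = a • Finsupp.single γ (1 : K) := by simp
      rw [ha, map_smul, map_smul, Polynomial.coeff_smul, map_smul, reesHom_std_single,
        Polynomial.coeff_monomial, Finsupp.smul_apply, Finsupp.smul_apply]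
      congr 1
      by_cases hγ : γ = β
      · rw [if_pos (by rw [hγ]), hN, hγ, Finsupp.single_eq_same, Finsupp.single_eq_same]
      · rw [Finsupp.single_eq_of_ne (Ne.symm hγ)]
        split_ifs with hdeg
        · rw [hN, Finsupp.single_eq_of_ne]
          exact fun hinit => hγ (eq_of_init_eq_of_wdeg_eq hinit.symm hdeg)
        · simp
  rw [injective_iff_map_eq_zero]
  intro x hx
  obtain ⟨p, rfl⟩ := h.std_surjective x
  have hp : p = 0 := by
    ext β
    rw [← hcoeff p β, hx]
    simp
  rw [hp, map_zero]

theorem iSup_reesPiece_le : ⨆ d, D.reesPiece ω d ≤ (D.reesAlgebra ω).toSubmodule :=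
  iSup_le fun d _ hx => Algebra.subset_adjoin (Set.mem_iUnion.2 ⟨d, hx⟩)

/-- Standard monomials span the presented algebra, and each is sent into one of the pieces. -/
theorem range_reesHom_le {gt : (Fin (n + 1) → ℕ) → (Fin (n + 1) → ℕ) → Prop}
    (h : (D.rees ω).IsAdmissible gt) :
    (D.reesHom ω hω).range.toSubmodule ≤ ⨆ d, D.reesPiece ω d := by
  rintro _ ⟨x, rfl⟩
  obtain ⟨p, rfl⟩ := h.std_surjective x
  change p ∈ (⨆ d, D.reesPiece ω d).comap ((D.reesHom ω hω).toLinearMap ∘ₗ (D.rees ω).std)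
  have htop : (⊤ : Submodule K (StdPoly K (n + 1))) ≤
      (⨆ d, D.reesPiece ω d).comap ((D.reesHom ω hω).toLinearMap ∘ₗ (D.rees ω).std) := by
    rw [← Finsupp.supported_univ, Finsupp.supported_eq_span_single, Submodule.span_le]
    rintro _ ⟨β, -, rfl⟩
    refine Submodule.mem_iSup_of_mem (wdeg (homWeight ω) β) ?_
    rw [← map_homogeneousPart hω]
    exact ⟨_, ⟨_, Finsupp.single_mem_supported K 1
      (show β ∈ {γ | wdeg (homWeight ω) γ = wdeg (homWeight ω) β} from rfl), rfl⟩, rfl⟩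
  exact htop trivial

theorem reesAlgebra_le_range : D.reesAlgebra ω ≤ (D.reesHom ω hω).range := by
  refine Algebra.adjoin_le (Set.iUnion_subset fun d x hx => ?_)
  have hx' : x ∈ D.reesPiece ω d := hx
  rw [← map_homogeneousPart hω] at hx'
  obtain ⟨y, -, rfl⟩ := hx'
  exact ⟨y, rfl⟩

end

/-! ### The grading of the Rees algebra -/

theorem mul_mem_of_mem_span {A : Type*} [Semiring A] [Algebra K A] {S T : Set A}
    {M : Submodule K A} (h : ∀ s ∈ S, ∀ t ∈ T, s * t ∈ M) {f g : A}
    (hf : f ∈ Submodule.span K S) (hg : g ∈ Submodule.span K T) : f * g ∈ M := by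
  have hle : Submodule.span K S * Submodule.span K T ≤ M := by
    rw [Submodule.span_mul_span, Submodule.span_le]
    rintro _ ⟨s, hs, t, ht, rfl⟩
    exact h s hs t ht
  exact hle (Submodule.mul_mem_mul hf hg)

/-- Multiplication by -1 in K supplies negatives, so the criterion for additive groups applies to
the given additive monoid. -/
theorem isInternal_of_iSupIndep {M ι : Type*} [DecidableEq ι] [AddCommMonoid M] [Module K M]
    {A : ι → Submodule K M} (h₁ : iSupIndep A) (h₂ : iSup A = ⊤) : DirectSum.IsInternal A :=
  letI := Module.addCommMonoidToAddCommGroup K (M := M)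
  (DirectSum.isInternal_submodule_iff_iSupIndep_and_iSup_eq_top A).2 ⟨h₁, h₂⟩

/-- The product of x^α and x^β is the class of a word of weight |α|_ω + |β|_ω, and reduction does
not raise the weight. -/
theorem IsAdmissible.mul_mem_filtration {gt : (Fin n → ℕ) → (Fin n → ℕ) → Prop}
    (h : D.IsAdmissible gt)
    (hω : ∀ i j : Fin n, i < j → ∀ α ∈ (D.d i j).support, wdeg ω α ≤ ω i + ω j) {a b : ℕ}
    {f g : D.Alg} (hf : f ∈ D.filtration ω a) (hg : g ∈ D.filtration ω b) :
    f * g ∈ D.filtration ω (a + b) := by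
  rw [filtration_eq_span] at hf hg
  refine mul_mem_of_mem_span ?_ hf hg
  rintro _ ⟨α, hα, rfl⟩ _ ⟨β, hβ, rfl⟩
  have h1 := h.proj_word_mem_filtration hω (stdWord α * stdWord β)
  rw [exponent_mul, exponent_stdWord, exponent_stdWord, wdeg_add, word_mul, map_mul,
    ← std_single, ← std_single] at h1
  exact filtration_mono (add_le_add hα hβ) h1

theorem IsAdmissible.gradedMonoid_reesGrading {gt : (Fin n → ℕ) → (Fin n → ℕ) → Prop}
    (h : D.IsAdmissible gt)
    (hω : ∀ i j : Fin n, i < j → ∀ α ∈ (D.d i j).support, wdeg ω α ≤ ω i + ω j) :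
    SetLike.GradedMonoid (D.reesGrading ω) where
  one_mem := by
    change (1 : Polynomial D.Alg) ∈ D.reesPiece ω 0
    refine ⟨1, ⟨Finsupp.single 0 1, Finsupp.single_mem_supported K 1
      (show (0 : Fin n → ℕ) ∈ {α | wdeg ω α ≤ 0} from (wdeg_zero ω).le), ?_⟩, rfl⟩
    have : stdWord (0 : Fin n → ℕ) = 1 := by simp [stdWord]
    rw [std_single, this, word, map_one, map_one]
  mul_mem := by
    rintro a b ⟨x, _⟩ ⟨y, _⟩ ⟨f, hf, hfx⟩ ⟨g, hg, hgy⟩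
    refine ⟨f * g, h.mul_mem_filtration hω hf hg, ?_⟩
    change Polynomial.monomial a f = x at hfx
    change Polynomial.monomial b g = y at hgy
    change Polynomial.monomial (a + b) (f * g) = x * y
    rw [← hfx, ← hgy, Polynomial.monomial_mul_monomial]

theorem isInternal_reesGrading
    (h : (D.reesAlgebra ω).toSubmodule = ⨆ d, D.reesPiece ω d) :
    DirectSum.IsInternal (D.reesGrading ω) := by
  have hmap : ∀ d, (D.reesGrading ω d).map (D.reesAlgebra ω).val.toLinearMap =
      D.reesPiece ω d := by
    intro d
    refine Submodule.map_comap_eq_of_le fun x hx => ?_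
    exact ⟨⟨x, iSup_reesPiece_le (Submodule.mem_iSup_of_mem d hx)⟩, rfl⟩
  refine isInternal_of_iSupIndep ?_ ?_
  · intro d
    rw [Submodule.disjoint_def]
    intro x hx hx'
    -- All pieces other than the d-th have zero coefficient at t^d, which gives independence.
    have hle : ⨆ e, ⨆ (_ : e ≠ d), D.reesGrading ω e ≤
        LinearMap.ker (((Polynomial.lcoeff D.Alg d).restrictScalars K) ∘ₗ
          (D.reesAlgebra ω).val.toLinearMap) := by
      refine iSup₂_le fun e hed y hy => ?_
      obtain ⟨f, -, hf⟩ := hy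
      change Polynomial.monomial e f = (y : Polynomial D.Alg) at hf
      change (y : Polynomial D.Alg).coeff d = 0
      rw [← hf, Polynomial.coeff_monomial_of_ne _ hed.symm]
    have h0 : (x : Polynomial D.Alg).coeff d = 0 := hle hx'
    obtain ⟨f, -, hf⟩ := hx
    change Polynomial.monomial d f = (x : Polynomial D.Alg) at hf
    rw [← hf, Polynomial.coeff_monomial_same] at h0
    rw [h0, map_zero] at hf
    exact Subtype.ext hf.symm
  · apply Submodule.map_injective_of_injective (f := (D.reesAlgebra ω).val.toLinearMap)
      Subtype.val_injective
    rw [Submodule.map_iSup, iSup_congr hmap, ← h, Submodule.map_top]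
    ext x
    exact ⟨fun hx => ⟨⟨x, hx⟩, rfl⟩, fun ⟨y, hy⟩ => hy ▸ y.2⟩

end Relations

end GAlg

end

/-! ### The theorem -/

theorem theorem2p7 {K : Type*} [Field K] {n : ℕ} (D : GAlg.Relations K n) (hD : D.IsGAlgebra)
    (ω : Fin n → ℕ) (hω_pos : ∀ i, 1 ≤ ω i)
    (hω : ∀ i j : Fin n, i < j → ∀ α ∈ (D.d i j).support, GAlg.wdeg ω α < ω i + ω j)
    (gt : (Fin n → ℕ) → (Fin n → ℕ) → Prop) (hgt : GAlg.IsMonomialOrdering gt) :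
    -- the relations in `x̃₁, …, x̃ₙ, t` define a G-algebra, graded by `ω̃ = (ω, 1)`,
    -- with admissible ordering `>_ω^h`
    (D.rees ω).IsGAlgebra ∧
    (D.rees ω).IsGradedBy (GAlg.homWeight ω) ∧
    (D.rees ω).IsAdmissible (GAlg.homOrdering ω gt) ∧
    -- the Rees algebra is the graded algebra `⨁ (F_d A) t^d`
    (D.reesAlgebra ω).toSubmodule = ⨆ d, D.reesPiece ω d ∧
    SetLike.GradedMonoid (D.reesGrading ω) ∧
    DirectSum.IsInternal (D.reesGrading ω) ∧
    -- it has the presentation above, with `x̃_i = x_i t^ω_i` and `d̃_ij = d_ij t^(ω_i + ω_j)`,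
    -- and its grading is the one by `ω̃`-weighted degree
    ∃ e : (D.rees ω).Alg ≃ₐ[K] D.reesAlgebra ω,
      (∀ i : Fin n, (e ((D.rees ω).var i.castSucc) : Polynomial D.Alg) =
        Polynomial.C (D.var i) * Polynomial.X ^ ω i) ∧
      (e ((D.rees ω).var (Fin.last n)) : Polynomial D.Alg) = Polynomial.X ∧
      (∀ i j : Fin n, i < j →
        (e ((D.rees ω).std ((D.rees ω).d i.castSucc j.castSucc)) : Polynomial D.Alg) =
          Polynomial.C (D.std (D.d i j)) * Polynomial.X ^ (ω i + ω j)) ∧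
      ∀ d : ℕ, ((D.rees ω).homogeneousPart (GAlg.homWeight ω) d).map e.toLinearMap =
        D.reesGrading ω d := by
  have hω' : ∀ i j : Fin n, i < j → ∀ α ∈ (D.d i j).support, GAlg.wdeg ω α ≤ ω i + ω j :=
    fun i j hij α hα => (hω i j hij α hα).le
  have hadm := GAlg.Relations.isAdmissible_rees hω hgt
  -- `gt` need not be admissible for `D`; the multiplicativity of the filtration of A is proved with
  -- `gt₀`.
  obtain ⟨gt₀, hgt₀⟩ := hD.exists_admissible
  have hsub : (D.reesAlgebra ω).toSubmodule ≤ (D.reesHom ω hω').range.toSubmodule :=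
    GAlg.Relations.reesAlgebra_le_range hω'
  have hrange : (D.reesHom ω hω').range = D.reesAlgebra ω :=
    le_antisymm ((GAlg.Relations.range_reesHom_le hω' hadm).trans
      GAlg.Relations.iSup_reesPiece_le) hsub
  -- The sum of the pieces lies in the Rees algebra, which lies in the range of `reesHom`, which
  -- lies in the sum of the pieces; so all three agree.
  have hiSup : (D.reesAlgebra ω).toSubmodule = ⨆ d, D.reesPiece ω d :=
    le_antisymm (hsub.trans (GAlg.Relations.range_reesHom_le hω' hadm))
      GAlg.Relations.iSup_reesPiece_le
  refine ⟨hD.rees hω, GAlg.Relations.isGradedBy_rees hω', hadm, hiSup,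
    hgt₀.gradedMonoid_reesGrading hω', GAlg.Relations.isInternal_reesGrading hiSup,
    (AlgEquiv.ofInjective _ (GAlg.Relations.reesHom_injective hω' hD hadm)).trans
      (Subalgebra.equivOfEq _ _ hrange), fun i => ?_, ?_, fun i j hij => ?_, fun d => ?_⟩
  · refine (GAlg.Relations.reesHom_proj hω' _).trans ?_
    rw [GAlg.Relations.weightHom_fvar_castSucc, Polynomial.mapAlgHom_monomial,
      Polynomial.C_mul_X_pow_eq_monomial]
    rfl
  · refine (GAlg.Relations.reesHom_proj hω' _).trans ?_
    rw [GAlg.Relations.weightHom_fvar_last]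
    exact Polynomial.map_X _
  · refine (GAlg.Relations.reesHom_proj hω' _).trans ?_
    rw [GAlg.Relations.rees_d_castSucc, GAlg.Relations.weightHom_homogenize (hω' i j hij),
      Polynomial.mapAlgHom_monomial, Polynomial.C_mul_X_pow_eq_monomial]
    rfl
  · ext x
    change _ ↔ (x : Polynomial D.Alg) ∈ D.reesPiece ω d
    rw [← GAlg.Relations.map_homogeneousPart hω']
    constructor
    · rintro ⟨y, hy, rfl⟩
      exact ⟨y, hy, rfl⟩
    · rintro ⟨y, hy, hyx⟩
      exact ⟨y, hy, Subtype.ext hyx⟩
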